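/- Let $\mathbb{P}$ be the set of primes, and give $2^{\mathbb{P}}$ (the space of all subsets of $\mathbb{P}$) the product topology of the discrete space $\{0,1\}$. For $W\subseteq\mathbb{P}$ let $R_W=\mathbb{Z}[\tfrac1p : p\in W]\subseteq\mathbb{Q}$. For a commutative ring $R$ let $\mathrm{HTP}(R)$ be the set of those polynomials $f\in\mathbb{Z}[X_0,X_1,\ldots]$ for which $f=0$ has a solution in $R$; by means of a fixed computable bijection from $\omega$ onto $\mathbb{Z}[X_0,X_1,\ldots]$, regard $\mathrm{HTP}(R)$ as a subset of $\omega$. Let $\leq_T$ denote Turing reducibility between subsets of $\omega$, where $A<_T B$ means that $A\leq_T B$ and $B\not\leq_T A$, and let $\emptyset'$ be the halting problem. If $\mathrm{HTP}(\mathbb{Q})$ is decidable, then the class $$\mathcal{D}=\{W\subseteq\mathbb{P} : (\exists D\subseteq\omega)\ [\,D\leq_T\emptyset'\ \text{and}\ \emptyset<_T D\leq_T \mathrm{HTP}(R_W)\,]\}$$ is meager in $2^{\mathbb{P}}$, i.e. it is a countable union of nowhere dense sets. -/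

import Mathlib

noncomputable section

namespace HTPBaire

/-- An explicit bijection between `ℕ` and the monomials in `X₀, X₁, …` (exponent vectors of finite
support).  The number `n` codes, through the standard bijection of `ℕ` with the finite multisets of
natural numbers (a multiset is listed in increasing order, and the list of its successive
differences is coded), a multiset `s`, and the exponent of `Xᵢ` is the multiplicity of `i` in `s`.
-/
def monomialEquiv : ℕ ≃ (ℕ →₀ ℕ) :=
  (Denumerable.eqv (Multiset ℕ)).symm.trans Multiset.toFinsupp.toEquiv

/-- A fixed computable bijection from `ℕ` onto `ℤ[X₀, X₁, …]`.  The number `n` codes a finitely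
supported function `e : ℕ → ℕ` (as in `monomialEquiv`); the coefficient of the `k`-th monomial is
the integer coded by `e k`, where `2 * m` codes `m` and `2 * m + 1` codes `-(m + 1)`. -/
def polyEquiv : ℕ ≃ MvPolynomial ℕ ℤ :=
  monomialEquiv.trans <|
    (Finsupp.mapRange.equiv Equiv.intEquivNat.symm rfl).trans <|
      (Finsupp.domCongr monomialEquiv).toEquiv.trans AddMonoidAlgebra.coeffEquiv.symm

/-- The coefficients of the polynomial with code `n`. -/
theorem coeff_polyEquiv (n k : ℕ) :
    (polyEquiv n).coeff (monomialEquiv k) = Equiv.intEquivNat.symm (monomialEquiv n k) := by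
  have h : (polyEquiv n).coeff (monomialEquiv k) =
      Equiv.intEquivNat.symm
        (monomialEquiv n (monomialEquiv.symm (monomialEquiv k))) := rfl
  rw [h, Equiv.symm_apply_apply]

/-- The exponents of the `k`-th monomial. -/
theorem monomialEquiv_apply (k i : ℕ) :
    monomialEquiv k i =
      ((Denumerable.raise (Denumerable.ofNat (List ℕ) k) 0 : List ℕ) : Multiset ℕ).count i := by
  have h : monomialEquiv k i = (Denumerable.ofNat (Multiset ℕ) k).count i := rfl
  have h' : Denumerable.ofNat (Multiset ℕ) k =
      Multiset.map (Denumerable.ofNat ℕ)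
        ((Denumerable.raise (Denumerable.ofNat (List ℕ) k) 0 : List ℕ) : Multiset ℕ) := by
    apply Denumerable.ofNat_of_decode
    rfl
  rw [h, h']
  have h2 : (Denumerable.ofNat ℕ : ℕ → ℕ) = id := by
    funext m
    simp
  rw [h2, Multiset.map_id]

/-- Hilbert's Tenth Problem for `R`: the set of `f ∈ ℤ[X₀, X₁, …]` that have a zero in `R`.
(A polynomial involves finitely many variables, so an assignment of values in `R` to all
variables is the same, for the purpose of a zero of `f`, as a tuple of elements of `R`.) -/
def HTP (R : Type*) [CommRing R] : Set (MvPolynomial ℕ ℤ) :=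
  {f | ∃ x : ℕ → R, f.eval₂ (Int.castRingHom R) x = 0}

/-- `HTP R` as a subset of `ℕ`, through the coding of polynomials. -/
def HTPCode (R : Type*) [CommRing R] : Set ℕ :=
  polyEquiv ⁻¹' HTP R

/-- The subring `R_W = ℤ[1/p : p ∈ W]` of `ℚ`. -/
def subringOf (W : Set Nat.Primes) : Subring ℚ :=
  Subring.closure {q | ∃ p ∈ W, q = ((p : ℕ) : ℚ)⁻¹}

open Classical in
/-- The characteristic function of `A ⊆ ℕ`, as a (total) partial function. -/
def chi (A : Set ℕ) : ℕ →. ℕ :=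
  fun n => Part.some (if n ∈ A then 1 else 0)

/-- Turing reducibility `A ≤_T B` of sets of natural numbers. -/
def SetTuringLE (A B : Set ℕ) : Prop :=
  TuringReducible (chi A) (chi B)

/-- `A <_T B`. -/
def SetTuringLT (A B : Set ℕ) : Prop :=
  SetTuringLE A B ∧ ¬ SetTuringLE B A

/-- The halting problem `∅'`: the set of all `e` such that the `e`-th program halts on input `e`. -/
def haltingSet : Set ℕ :=
  {e | ((Nat.Partrec.Code.ofNatCode e).eval e).Dom}

/-- A set of natural numbers is decidable. -/
def DecidableSet (A : Set ℕ) : Prop :=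
  ComputablePred fun n => n ∈ A

end HTPBaire

end

/-! The argument is finite forcing. A condition (a, L) puts the primes dividing a into W and keeps
the primes listed in L out of W. If f has a rational zero whose denominators avoid L, multiplying a
by these denominators forces f into HTP(R_W); if not, L alone forces f out. So the W for which every
f is decided by a condition that W meets form a comeagre set, `genericSets`.

If HTP(ℚ) is decidable, so is forcing. A positive fact is witnessed by an explicit zero. A negative
fact requires integrality at p to be Diophantine over ℚ, uniformly in p; this is
`IsAuxPair.not_dvd_den_iff`. Choose q such that -q is not a norm from ℚ_p(√-p), and put N = 1 +
p³(8p-1)x⁶. Then x is p-integral iff some d makes N of the form r² + ds² and qd of the form r'² +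
ps'². If p divides the denominator of x, then N is -p times a nonzero p-adic square, and the two
conics would make -q a norm. Otherwise, up to a sixth power, N is a positive integer prime to p, and
Dirichlet's theorem with quadratic reciprocity gives a prime d for which both conics have rational
points (`exists_sq_add_mul_sq_eq`).

Now suppose that one program computes D from HTP(R_W) for a set of generic W that is dense in some
cylinder. Any forced finite list of oracle values inside that cylinder is realised by such a W, so
an answer computed from the list is correct; genericity ensures that enough values can be forced.
Searching for such lists computes D. Hence for noncomputable D and a fixed program these W form a
nowhere dense set (`isNowhereDense_computingSets`). There are countably many programs and countably
many D ≤_T ∅', and only this countability is used of ∅'. -/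

namespace HTPBaire

/-! ### Rational points on x² + ay² = bz², and quadratic reciprocity -/

section Conics

open NumberTheorySymbols

/-- A pigeonhole proof of a case of Legendre's theorem. Two box points congruent modulo a and b
differ by a vector with x² + ay² - bz² = k·ab. The box sizes give k ≤ 2, and k > -1 because a is not
a square, which makes bz² < ab strict. -/
theorem exists_sq_add_mul_sq_eq {a b : ℕ} (ha : 0 < a) (hb : 0 < b) (hab : a.Coprime b)
    (hsq : ¬ IsSquare a) {s w : ℤ} (hs : (b : ℤ) ∣ s ^ 2 + a) (hw : (a : ℤ) ∣ w ^ 2 - b) :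
    ∃ x y z : ℤ, z ≠ 0 ∧ x ^ 2 + a * y ^ 2 = b * z ^ 2 := by
  classical
  have : NeZero a := ⟨ha.ne'⟩
  have : NeZero b := ⟨hb.ne'⟩
  let box := Finset.range (Nat.sqrt (a * b) + 1) ×ˢ
    (Finset.range (Nat.sqrt b + 1) ×ˢ Finset.range (Nat.sqrt a + 1))
  let φ : ℕ × ℕ × ℕ → ZMod b × ZMod a := fun v =>
    ((v.1 : ZMod b) - s * v.2.1, (v.1 : ZMod a) - w * v.2.2)
  -- Each side has ⌊√·⌋ + 1 points, more than the root itself, so the box has more than √(ab)·√b·√a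
  -- = ab points.
  have hcard : (Finset.univ : Finset (ZMod b × ZMod a)).card < box.card := by
    simp only [box, Finset.card_product, Finset.card_range, Finset.card_univ, Fintype.card_prod,
      ZMod.card]
    have h1 := Nat.lt_succ_sqrt' (a * b)
    have h2 := Nat.lt_succ_sqrt' b
    have h3 := Nat.lt_succ_sqrt' a
    simp only [Nat.succ_eq_add_one] at h1 h2 h3
    refine lt_of_pow_lt_pow_left₀ 2 (Nat.zero_le _) ?_
    calc (b * a) ^ 2 = (a * b) * (b * a) := by ring
      _ < (Nat.sqrt (a * b) + 1) ^ 2 * ((Nat.sqrt b + 1) ^ 2 * (Nat.sqrt a + 1) ^ 2) := by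
        gcongr
      _ = _ := by ring
  obtain ⟨u, hu, v, hv, huv, he⟩ := Finset.exists_ne_map_eq_of_card_lt_of_maps_to hcard
    (f := φ) (fun _ _ => Finset.mem_coe.2 (Finset.mem_univ _))
  obtain ⟨u1, u2, u3⟩ := u
  obtain ⟨v1, v2, v3⟩ := v
  simp only [box, Finset.mem_product, Finset.mem_range, Nat.lt_succ_iff] at hu hv
  simp only [φ, Prod.mk.injEq] at he
  have bound : ∀ {n i j : ℕ}, i ≤ Nat.sqrt n → j ≤ Nat.sqrt n → ((i : ℤ) - j) ^ 2 ≤ n := by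
    intro n i j hi hj
    have h : (Nat.sqrt n : ℤ) ^ 2 ≤ n := by exact_mod_cast Nat.sqrt_le' n
    have hi' : (i : ℤ) ≤ Nat.sqrt n := by exact_mod_cast hi
    have hj' : (j : ℤ) ≤ Nat.sqrt n := by exact_mod_cast hj
    nlinarith
  set x : ℤ := (u1 : ℤ) - v1 with hx
  set y : ℤ := (u2 : ℤ) - v2 with hy
  set z : ℤ := (u3 : ℤ) - v3 with hz
  have hx2 : x ^ 2 ≤ (a * b : ℕ) := bound hu.1 hv.1
  have hy2 : y ^ 2 ≤ b := bound hu.2.1 hv.2.1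
  have hz2 : z ^ 2 ≤ a := bound hu.2.2 hv.2.2
  have hb1 : (b : ℤ) ∣ x - s * y := by
    rw [← ZMod.intCast_zmod_eq_zero_iff_dvd]
    push_cast [hx, hy]
    linear_combination he.1
  have ha1 : (a : ℤ) ∣ x - w * z := by
    rw [← ZMod.intCast_zmod_eq_zero_iff_dvd]
    push_cast [hx, hz]
    linear_combination he.2
  clear_value x y z
  have hdb : (b : ℤ) ∣ x ^ 2 + a * y ^ 2 - b * z ^ 2 := by
    have h : x ^ 2 + a * y ^ 2 - b * z ^ 2 =
        (x - s * y) * (x + s * y) + (s ^ 2 + a) * y ^ 2 + b * (- z ^ 2) := by ring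
    rw [h]
    exact dvd_add (dvd_add (hb1.mul_right _) (hs.mul_right _)) (dvd_mul_right _ _)
  have hda : (a : ℤ) ∣ x ^ 2 + a * y ^ 2 - b * z ^ 2 := by
    have h : x ^ 2 + a * y ^ 2 - b * z ^ 2 =
        (x - w * z) * (x + w * z) + (w ^ 2 - b) * z ^ 2 + a * (y ^ 2) := by ring
    rw [h]
    exact dvd_add (dvd_add (ha1.mul_right _) (hw.mul_right _)) (dvd_mul_right _ _)
  obtain ⟨k, hk⟩ : (a * b : ℤ) ∣ x ^ 2 + a * y ^ 2 - b * z ^ 2 :=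
    (Nat.isCoprime_iff_coprime.2 hab).mul_dvd hda hdb
  push_cast at hx2
  have ha' : (0 : ℤ) < a := by exact_mod_cast ha
  have hb' : (0 : ℤ) < b := by exact_mod_cast hb
  have habp : (0 : ℤ) < a * b := mul_pos ha' hb'
  have hay : a * y ^ 2 ≤ (a * b : ℤ) := by nlinarith
  have hbz : b * z ^ 2 ≤ (a * b : ℤ) := by nlinarith
  have hz2' : z ^ 2 ≠ a := by
    intro h
    refine hsq ⟨z.natAbs, ?_⟩
    zify
    rw [← h, ← abs_mul, abs_mul_self, sq]
  have hlt : b * z ^ 2 < (a * b : ℤ) := by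
    have : z ^ 2 < a := lt_of_le_of_ne hz2 hz2'
    nlinarith
  have hk1 : -1 < k := by
    by_contra! h
    have h1 : (a * b : ℤ) * k ≤ a * b * (-1) := mul_le_mul_of_nonneg_left h habp.le
    have h2 : (0 : ℤ) ≤ a * y ^ 2 := by positivity
    linarith [sq_nonneg x]
  have hk2 : k ≤ 2 := by
    by_contra! h
    have h1 : (a * b : ℤ) * 3 ≤ a * b * k := mul_le_mul_of_nonneg_left h habp.le
    have h2 : (0 : ℤ) ≤ b * z ^ 2 := by positivity
    linarith
  have hb_sq : y ^ 2 = b → ∃ x y z : ℤ, z ≠ 0 ∧ x ^ 2 + a * y ^ 2 = b * z ^ 2 :=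
    fun h => ⟨y, 0, 1, one_ne_zero, by rw [h]; ring⟩
  -- For k = 0 the difference vector is a solution. For k = 1, x² + ay² = b(z² + a); multiply by z²
  -- + a and compose the norms. For k = 2 the bounds on x² and ay² are attained, so b = y².
  interval_cases k
  · refine ⟨x, y, z, ?_, by linarith⟩
    rintro hz0
    rw [hz0] at hk
    have h2 : (0 : ℤ) ≤ a * y ^ 2 := by positivity
    have hx0 : x = 0 := by
      have : x ^ 2 = 0 := by linarith [sq_nonneg x]
      simpa using this
    have hy0 : y = 0 := by
      have : (a : ℤ) * y ^ 2 = 0 := by linarith [sq_nonneg x]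
      simpa [ha.ne'] using this
    apply huv
    rw [hx, sub_eq_zero] at hx0
    rw [hy, sub_eq_zero] at hy0
    rw [hz, sub_eq_zero] at hz0
    simp only [Prod.mk.injEq]
    exact ⟨by exact_mod_cast hx0, by exact_mod_cast hy0, by exact_mod_cast hz0⟩
  · refine ⟨x * z - a * y, x + y * z, z ^ 2 + a, by positivity, ?_⟩
    have : x ^ 2 + a * y ^ 2 = b * (z ^ 2 + a) := by linarith
    linear_combination (z ^ 2 + a) * this
  · apply hb_sq
    have : (a : ℤ) * (y ^ 2) = a * b := by
      have h2 : (0 : ℤ) ≤ b * z ^ 2 := by positivity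
      linarith
    exact mul_left_cancel₀ ha'.ne' this

/-- Since d ≡ -1 mod m, the symbol (d/m) is (-1/m), and the sign of reciprocity cancels it. -/
theorem jacobiSym_eq_one_of_dvd_add_one {m d : ℕ} (hm : Odd m) (hd : Odd d) (h : m ∣ d + 1)
    (h4 : d % 4 = 3 ∨ m % 4 = 1) : J(m | d) = 1 := by
  have hJ : J(d | m) = ZMod.χ₄ m := by
    rw [← jacobiSym.at_neg_one hm]
    apply jacobiSym.mod_left'
    refine (Int.modEq_iff_dvd.2 ?_ : -1 ≡ d [ZMOD m]).symm
    simpa using (by exact_mod_cast h : (m : ℤ) ∣ d + 1)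
  rcases Nat.odd_mod_four_iff.1 (Nat.odd_iff.1 hm) with hm4 | hm4
  · rw [jacobiSym.quadratic_reciprocity_one_mod_four hm4 hd, hJ, ZMod.χ₄_nat_one_mod_four hm4]
  · have hd4 : d % 4 = 3 := by omega
    rw [jacobiSym.quadratic_reciprocity_three_mod_four hm4 hd4, hJ,
      ZMod.χ₄_nat_three_mod_four hm4, neg_neg]

theorem jacobiSym_eq_one_of_dvd_add_one_of_mod_eight {m d : ℕ} (hm : m ≠ 0) (hd : d % 8 = 7)
    (h : m ∣ d + 1) : J(m | d) = 1 := by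
  have hd' : Odd d := Nat.odd_iff.2 (by omega)
  obtain ⟨k, m', hm', rfl⟩ := Nat.exists_eq_two_pow_mul_odd hm
  have h2 : J(2 | d) = 1 := by
    rw [jacobiSym.at_two hd', ZMod.χ₈_nat_eq_if_mod_eight]
    simp [hd, show d % 2 ≠ 0 by omega]
  push_cast
  rw [jacobiSym.mul_left, jacobiSym.pow_left, h2, one_pow, one_mul]
  exact jacobiSym_eq_one_of_dvd_add_one hm' hd' ((dvd_mul_left _ _).trans h) (Or.inl (by omega))

theorem jacobiSym_neg_eq_one {p l : ℕ} [Fact p.Prime] (hp : Odd p) (hl : l % 4 = 3)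
    (h : J(-l | p) = -1) : J(-p | l) = 1 := by
  have hl' : Odd l := Nat.odd_iff.2 (by omega)
  rw [jacobiSym.neg _ hp] at h
  rw [jacobiSym.neg _ hl', ZMod.χ₄_nat_three_mod_four hl]
  rcases Nat.odd_mod_four_iff.1 (Nat.odd_iff.1 hp) with hp4 | hp4
  · rw [ZMod.χ₄_nat_one_mod_four hp4] at h
    rw [jacobiSym.quadratic_reciprocity_one_mod_four hp4 hl']
    linarith
  · rw [ZMod.χ₄_nat_three_mod_four hp4] at h
    rw [jacobiSym.quadratic_reciprocity_three_mod_four hp4 hl]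
    linarith

theorem exists_dvd_sq_sub_of_jacobiSym_eq_one {a : ℤ} {l : ℕ} (hl : l.Prime)
    (h : J(a | l) = 1) : ∃ w : ℤ, (l : ℤ) ∣ w ^ 2 - a := by
  have := Fact.mk hl
  obtain ⟨r, hr⟩ := ZMod.isSquare_of_jacobiSym_eq_one h
  obtain ⟨w, rfl⟩ := ZMod.intCast_surjective r
  refine ⟨w, ?_⟩
  rw [← ZMod.intCast_zmod_eq_zero_iff_dvd]
  push_cast
  rw [hr]
  ring

theorem exists_dvd_sq_add {a : ℤ} {m n : ℕ} (hmn : m.Coprime n)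
    (hm : ∃ s : ℤ, (m : ℤ) ∣ s ^ 2 + a) (hn : ∃ s : ℤ, (n : ℤ) ∣ s ^ 2 + a) :
    ∃ s : ℤ, ((m * n : ℕ) : ℤ) ∣ s ^ 2 + a := by
  obtain ⟨s, hs⟩ := hm
  obtain ⟨t, ht⟩ := hn
  have hc : IsCoprime (m : ℤ) n := Nat.isCoprime_iff_coprime.2 hmn
  obtain ⟨u, v, huv⟩ := id hc
  refine ⟨s * (v * n) + t * (u * m), ?_⟩
  push_cast
  refine hc.mul_dvd ?_ ?_
  · have h : (s * (v * n) + t * (u * m)) ^ 2 + a = s ^ 2 + a +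
      m * (u * (t - s) * (2 * s + u * m * (t - s))) := by
      have : v * n = 1 - u * m := by linarith
      rw [this]; ring
    rw [h]
    exact dvd_add hs (dvd_mul_right _ _)
  · have h : (s * (v * n) + t * (u * m)) ^ 2 + a = t ^ 2 + a +
      n * (v * (s - t) * (2 * t + v * n * (s - t))) := by
      have : u * m = 1 - v * n := by linarith
      rw [this]; ring
    rw [h]
    exact dvd_add ht (dvd_mul_right _ _)

end Conics

/-! ### Integrality at p implies solvability of the two conics -/

section LocalFormula

open NumberTheorySymbols

/-- A pair of a prime `p` and a number `q` such that `-q` is not a norm from `ℚ_p(√-p)`. -/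
def IsAuxPair (p q : ℕ) : Prop :=
  (p = 2 ∧ q = 1) ∨ (p ≠ 2 ∧ p.Prime ∧ q.Prime ∧ q % 8 = 7 ∧ ∀ t < p, ¬ p ∣ t ^ 2 + q)

theorem IsAuxPair.prime {p q : ℕ} (h : IsAuxPair p q) : p.Prime := by
  rcases h with ⟨rfl, -⟩ | h
  · exact Nat.prime_two
  · exact h.2.1

theorem not_isSquare_neg_iff {p : ℕ} [NeZero p] (q : ℕ) :
    (∀ t < p, ¬ p ∣ t ^ 2 + q) ↔ ¬ IsSquare (-q : ZMod p) := by
  constructor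
  · rintro h ⟨r, hr⟩
    refine h r.val r.val_lt ?_
    rw [← ZMod.natCast_eq_zero_iff]
    push_cast
    rw [ZMod.natCast_rightInverse r]
    linear_combination -hr
  · intro h t _ ht
    refine h ⟨t, ?_⟩
    rw [← ZMod.natCast_eq_zero_iff] at ht
    push_cast at ht
    linear_combination -ht

theorem exists_isAuxPair {p : ℕ} (hp : p.Prime) : ∃ q, IsAuxPair p q := by
  by_cases h2 : p = 2
  · exact ⟨1, Or.inl ⟨h2, rfl⟩⟩
  have := Fact.mk hp
  obtain ⟨u, hu⟩ := FiniteField.exists_nonsquare (F := ZMod p) (by rwa [ZMod.ringChar_zmod_n])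
  have hodd := hp.odd_of_ne_two h2
  have hc : Nat.Coprime 8 p := by
    rw [show 8 = 2 ^ 3 by norm_num]
    exact (Nat.coprime_two_left.2 hodd).pow_left 3
  -- Dirichlet's theorem is applied to q ≡ 7 mod 8 and q ≡ -u mod p, so that -q is the nonsquare u.
  obtain ⟨k, hk8, hkp⟩ := Nat.chineseRemainder hc 7 (-u).val
  have hk1 : k.Coprime 8 := by
    rw [Nat.coprime_iff_gcd_eq_one, hk8.gcd_eq]; rfl
  have hk0 : (k : ZMod p) = -u := by
    rw [(ZMod.natCast_eq_natCast_iff _ _ _).2 hkp, ZMod.natCast_rightInverse]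
  have hk2 : k.Coprime p := by
    rw [← ZMod.isUnit_iff_coprime, hk0]
    rw [isUnit_iff_ne_zero, neg_ne_zero]
    rintro rfl
    exact hu IsSquare.zero
  obtain ⟨q, -, hq, hqk⟩ := Nat.forall_exists_prime_gt_and_modEq 0 (q := 8 * p)
    (by have := hp.pos; omega) (hk1.mul_right hk2)
  refine ⟨q, Or.inr ⟨h2, hp, hq, ?_, ?_⟩⟩
  · exact (hqk.of_mul_right p).trans hk8
  · rw [not_isSquare_neg_iff, (ZMod.natCast_eq_natCast_iff _ _ _).2 (hqk.of_mul_left 8), hk0,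
      neg_neg]
    exact hu

theorem jacobiSym_neg_eq_neg_one {p q : ℕ} [Fact p.Prime] (h : ¬ IsSquare (-q : ZMod p)) :
    J(-q | p) = -1 := by
  apply ZMod.nonsquare_iff_jacobiSym_eq_neg_one.2
  push_cast
  exact h

theorem exists_rat_conic {a b : ℕ} (h : ∃ x y z : ℤ, z ≠ 0 ∧ x ^ 2 + a * y ^ 2 = b * z ^ 2) :
    ∃ r s : ℚ, (b : ℚ) = r ^ 2 + a * s ^ 2 := by
  obtain ⟨x, y, z, hz, h⟩ := h
  refine ⟨x / z, y / z, ?_⟩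
  have hz' : (z : ℚ) ≠ 0 := by exact_mod_cast hz
  have h' : (x : ℚ) ^ 2 + a * y ^ 2 = b * z ^ 2 := by exact_mod_cast h
  field_simp
  linarith

theorem not_isSquare_of_prime {p : ℕ} (hp : p.Prime) : ¬ IsSquare p := by
  rintro ⟨r, hr⟩
  have := Nat.prime_iff.1 hp |>.irreducible.not_isSquare
  exact this ⟨r, hr⟩

/-- A prime d ≡ -1 mod 8m with d ≡ q mod p serves both conics. For the first, -d ≡ 1 mod m, and m is
a square mod d by reciprocity. For the second, -p is a square mod q and mod d because -q and -d are
nonresidues mod p, while qd ≡ q² mod p. -/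
theorem exists_conics_of_odd {p q m : ℕ} (h2 : p ≠ 2) (hp : p.Prime) (hq : q.Prime)
    (hq8 : q % 8 = 7) (hqp : ∀ t < p, ¬ p ∣ t ^ 2 + q) (hm : m.Coprime p) (hm0 : m ≠ 0) :
    ∃ d r s r' s' : ℚ, (m : ℚ) = r ^ 2 + d * s ^ 2 ∧ q * d = r' ^ 2 + p * s' ^ 2 := by
  have := Fact.mk hp
  have hodd := hp.odd_of_ne_two h2
  rw [not_isSquare_neg_iff] at hqp
  have hqp' : q.Coprime p := by
    rw [← ZMod.isUnit_iff_coprime, isUnit_iff_ne_zero]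
    intro h
    rw [h, neg_zero] at hqp
    exact hqp IsSquare.zero
  have hc : Nat.Coprime (8 * m) p := by
    refine Nat.Coprime.mul_left ?_ hm
    rw [show 8 = 2 ^ 3 by norm_num]
    exact (Nat.coprime_two_left.2 hodd).pow_left 3
  obtain ⟨k, hk8, hkp⟩ := Nat.chineseRemainder hc (8 * m - 1) q
  have hk1 : k.Coprime (8 * m) := by
    rw [Nat.coprime_iff_gcd_eq_one, hk8.gcd_eq]
    exact Nat.coprime_self_sub_left (by omega) |>.2 (Nat.coprime_one_left _)
  have hk2 : k.Coprime p := by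
    rw [Nat.coprime_iff_gcd_eq_one, hkp.gcd_eq]
    exact hqp'
  -- The bound d > q makes q and d distinct primes, as the Chinese remainder step for qd requires.
  obtain ⟨d, hdq, hd, hdk⟩ := Nat.forall_exists_prime_gt_and_modEq q (q := 8 * m * p)
    (by have := hp.pos; positivity) (hk1.mul_right hk2)
  have hdm : d ≡ 8 * m - 1 [MOD 8 * m] := (hdk.of_mul_right p).trans hk8
  have hdp : d ≡ q [MOD p] := (hdk.of_mul_left (8 * m)).trans hkp
  have hdvd : 8 * m ∣ d + 1 := by
    rw [← Nat.modEq_zero_iff_dvd]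
    refine (hdm.add_right 1).trans ?_
    rw [Nat.sub_add_cancel (by omega)]
    exact Nat.modEq_zero_iff_dvd.2 dvd_rfl
  have hd8 : d % 8 = 7 := by
    have := (dvd_mul_right 8 m).trans hdvd
    omega
  have hmd : m ∣ d + 1 := (dvd_mul_left m 8).trans hdvd
  have hdp' : ¬ IsSquare (-d : ZMod p) := by
    rwa [(ZMod.natCast_eq_natCast_iff _ _ _).2 hdp]
  have hsq : ∀ l : ℕ, l.Prime → l % 8 = 7 → ¬ IsSquare (-l : ZMod p) →
      ∃ s : ℤ, (l : ℤ) ∣ s ^ 2 + p := by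
    intro l hl hl8 hlp
    obtain ⟨s, hs⟩ := exists_dvd_sq_sub_of_jacobiSym_eq_one hl
      (jacobiSym_neg_eq_one hodd (by omega) (jacobiSym_neg_eq_neg_one hlp))
    exact ⟨s, by simpa using hs⟩
  obtain ⟨w, hw⟩ := exists_dvd_sq_sub_of_jacobiSym_eq_one hd
    (jacobiSym_eq_one_of_dvd_add_one_of_mod_eight hm0 hd8 hmd)
  obtain ⟨r, s, hrs⟩ := exists_rat_conic <| exists_sq_add_mul_sq_eq (a := d) (b := m) hd.pos
    (Nat.pos_of_ne_zero hm0)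
    ((Nat.coprime_self_add_right.2 (Nat.coprime_one_right d)).coprime_dvd_right hmd)
    (not_isSquare_of_prime hd) (s := 1) (by simpa [add_comm] using (by exact_mod_cast hmd : (m : ℤ) ∣ d + 1)) hw
  have hqd : q.Coprime d := (Nat.coprime_primes hq hd).2 hdq.ne
  have hpd : p.Coprime d := by
    rw [Nat.coprime_comm, Nat.coprime_iff_gcd_eq_one, hdp.gcd_eq]
    exact hqp'
  obtain ⟨t, ht⟩ := exists_dvd_sq_add hqd (hsq q hq hq8 hqp) (hsq d hd hd8 hdp')
  obtain ⟨r', s', hrs'⟩ := exists_rat_conic <| exists_sq_add_mul_sq_eq (a := p) (b := q * d) hp.pos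
    (Nat.mul_pos hq.pos hd.pos) (hqp'.symm.mul_right hpd) (not_isSquare_of_prime hp) (w := q) ht
    (by
      have : (p : ℤ) ∣ q - d := Nat.modEq_iff_dvd.1 hdp
      rw [show (q : ℤ) ^ 2 - (q * d : ℕ) = q * (q - d) by push_cast; ring]
      exact this.mul_left _)
  exact ⟨d, r, s, r', s', hrs, by exact_mod_cast hrs'⟩

/-- Here q = 1, and a prime d ≡ 1 mod 8 with d ≡ -1 mod m works: -2 is a square mod d, and m is one
by reciprocity. -/
theorem exists_conics_of_two {m : ℕ} (hm : m % 8 = 1) :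
    ∃ d r s r' s' : ℚ, (m : ℚ) = r ^ 2 + d * s ^ 2 ∧ d = r' ^ 2 + 2 * s' ^ 2 := by
  have hodd : Odd m := Nat.odd_iff.2 (by omega)
  have hc : Nat.Coprime 8 m := by
    rw [show 8 = 2 ^ 3 by norm_num]
    exact (Nat.coprime_two_left.2 hodd).pow_left 3
  obtain ⟨k, hk8, hkm⟩ := Nat.chineseRemainder hc 1 (m - 1)
  have hk1 : k.Coprime 8 := by
    rw [Nat.coprime_iff_gcd_eq_one, hk8.gcd_eq]; rfl
  have hk2 : k.Coprime m := by
    rw [Nat.coprime_iff_gcd_eq_one, hkm.gcd_eq]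
    exact Nat.coprime_self_sub_left (by omega) |>.2 (Nat.coprime_one_left _)
  obtain ⟨d, -, hd, hdk⟩ := Nat.forall_exists_prime_gt_and_modEq 0 (q := 8 * m)
    (by omega) (hk1.mul_right hk2)
  have hd8 : d % 8 = 1 := (hdk.of_mul_right m).trans hk8
  have hdm : d ≡ m - 1 [MOD m] := (hdk.of_mul_left 8).trans hkm
  have hmd : m ∣ d + 1 := by
    rw [← Nat.modEq_zero_iff_dvd]
    refine (hdm.add_right 1).trans ?_
    rw [Nat.sub_add_cancel (by omega)]
    exact Nat.modEq_zero_iff_dvd.2 dvd_rfl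
  have hdodd : Odd d := Nat.odd_iff.2 (by omega)
  obtain ⟨w, hw⟩ := exists_dvd_sq_sub_of_jacobiSym_eq_one hd
    (jacobiSym_eq_one_of_dvd_add_one hodd hdodd hmd (Or.inr (by omega)))
  obtain ⟨r, s, hrs⟩ := exists_rat_conic <| exists_sq_add_mul_sq_eq (a := d) (b := m) hd.pos
    (by omega)
    ((Nat.coprime_self_add_right.2 (Nat.coprime_one_right d)).coprime_dvd_right hmd)
    (not_isSquare_of_prime hd) (s := 1) (by simpa [add_comm] using (by exact_mod_cast hmd : (m : ℤ) ∣ d + 1)) hw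
  have := Fact.mk hd
  obtain ⟨t, ht⟩ : ∃ t : ℤ, (d : ℤ) ∣ t ^ 2 - (-2) := by
    refine exists_dvd_sq_sub_of_jacobiSym_eq_one hd ?_
    rw [jacobiSym.at_neg_two hdodd, ZMod.χ₈'_nat_eq_if_mod_eight]
    simp [hd8, show d % 2 ≠ 0 by omega]
  obtain ⟨r', s', hrs'⟩ := exists_rat_conic <| exists_sq_add_mul_sq_eq (a := 2) (b := d) two_pos
    hd.pos (Nat.coprime_two_left.2 hdodd) (not_isSquare_of_prime Nat.prime_two) (s := t) (w := 1)
    (by simpa using ht) (by push_cast; omega)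
  exact ⟨d, r, s, r', s', hrs, by exact_mod_cast hrs'⟩

theorem IsAuxPair.exists_conics {p q : ℕ} (h : IsAuxPair p q) {x : ℚ} (hx : ¬ p ∣ x.den) :
    ∃ d r s r' s' : ℚ, 1 + p ^ 3 * (8 * p - 1) * x ^ 6 = r ^ 2 + d * s ^ 2 ∧
      q * d = r' ^ 2 + p * s' ^ 2 := by
  have hp := h.prime
  set n := x.den with hn
  set m := x.num.natAbs with hm
  have hn0 : n ≠ 0 := x.den_nz
  have hm6 : (m : ℚ) ^ 6 = (x.num : ℚ) ^ 6 := by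
    have : (m : ℤ) ^ 6 = x.num ^ 6 := by
      rw [hm, Int.natCast_natAbs]
      exact Even.pow_abs (by decide) _
    exact_mod_cast this
  -- Clearing the denominator n⁶ = (n³)² only rescales r and s. As p does not divide n, M is prime
  -- to p, and it is 1 mod 8 when p = 2.
  set M := n ^ 6 + p ^ 3 * (8 * p - 1) * m ^ 6 with hM
  have hM' : (M : ℚ) = (1 + p ^ 3 * (8 * p - 1) * x ^ 6) * n ^ 6 := by
    have h8 : ((8 * p - 1 : ℕ) : ℚ) = 8 * p - 1 := by
      rw [Nat.cast_sub (by have := hp.pos; omega)]; norm_num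
    rw [hM]
    push_cast
    rw [h8, hm6]
    have hn3 : (n : ℚ) ≠ 0 := by exact_mod_cast hn0
    have hxn : (x.num : ℚ) = x * n := by
      rw [eq_comm, hn]
      exact Rat.mul_den_eq_num x
    rw [hxn]
    ring
  obtain ⟨d, r, s, r', s', h1, h2⟩ : ∃ d r s r' s' : ℚ, (M : ℚ) = r ^ 2 + d * s ^ 2 ∧
      q * d = r' ^ 2 + p * s' ^ 2 := by
    rcases h with ⟨rfl, rfl⟩ | ⟨h2, -, hq, hq8, hqp⟩
    · have hM8 : M % 8 = 1 := by
        have hn2 : n % 8 = 1 ∨ n % 8 = 3 ∨ n % 8 = 5 ∨ n % 8 = 7 := by omega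
        rw [hM, show 2 ^ 3 * (8 * 2 - 1) * m ^ 6 = 8 * (15 * m ^ 6) by ring, Nat.add_mul_mod_self_left, Nat.pow_mod]
        rcases hn2 with h | h | h | h <;> rw [h]
      obtain ⟨d, r, s, r', s', h1, h2⟩ := exists_conics_of_two hM8
      exact ⟨d, r, s, r', s', h1, by simpa using h2⟩
    · refine exists_conics_of_odd h2 hp hq hq8 hqp ?_ ?_
      · rw [hM, Nat.coprime_comm, hp.coprime_iff_not_dvd]
        intro hd
        rw [Nat.dvd_add_left] at hd
        · exact hx (hp.dvd_of_dvd_pow hd)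
        · rw [pow_succ, mul_assoc, mul_assoc]
          exact (dvd_mul_right p _).mul_left _
      · have := pow_pos (Nat.pos_of_ne_zero hn0) 6
        omega
  have hn3 : (n : ℚ) ≠ 0 := by exact_mod_cast hn0
  refine ⟨d, r / n ^ 3, s / n ^ 3, r', s', ?_, h2⟩
  rw [h1] at hM'
  field_simp
  linarith

end LocalFormula

/-! ### Solvability of the conics implies integrality at p -/

section Padic

variable {p : ℕ} [hp : Fact p.Prime]

theorem exists_sq_eq_one_add {c : ℤ_[p]} (hc : ‖c‖ < ‖(2 : ℤ_[p])‖ ^ 2) :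
    ∃ w : ℤ_[p], w ^ 2 = 1 + c := by
  obtain ⟨z, hz, -⟩ := hensels_lemma (p := p) (R := ℤ_[p])
    (F := Polynomial.X ^ 2 - Polynomial.C (1 + c)) (a := 1) (by simpa [one_add_one_eq_two] using hc)
  refine ⟨z, ?_⟩
  simpa [sub_eq_zero] using hz

/-- A nonzero u² has even valuation, a nonzero pw² odd valuation. -/
theorem norm_sq_ne_norm_prime_mul_sq {u w : ℚ_[p]} (h : u ≠ 0 ∨ w ≠ 0) :
    ‖u ^ 2‖ ≠ ‖(p : ℚ_[p]) * w ^ 2‖ := by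
  intro he
  have hp0 : (p : ℚ_[p]) ≠ 0 := by exact_mod_cast hp.1.ne_zero
  have huw : u = 0 ↔ w = 0 := by
    rw [← pow_eq_zero_iff (n := 2) two_ne_zero, ← norm_eq_zero, he, norm_eq_zero]
    simp [hp0]
  have hu : u ≠ 0 := by tauto
  have hw : w ≠ 0 := by tauto
  rw [norm_mul, norm_pow, norm_pow, Padic.norm_eq_zpow_neg_valuation hu,
    Padic.norm_eq_zpow_neg_valuation hw, Padic.norm_p] at he
  have hp1 : (1 : ℝ) < p := by exact_mod_cast hp.1.one_lt
  have hpne : (p : ℝ) ≠ 0 := by positivity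
  rw [← zpow_natCast, ← zpow_mul, ← zpow_natCast, ← zpow_mul, ← zpow_neg_one, ← zpow_add₀ hpne] at he
  have := zpow_right_injective₀ (by positivity) hp1.ne' he
  push_cast at this
  omega

theorem sq_add_prime_mul_sq_ne_zero {u w : ℚ_[p]} (h : u ≠ 0 ∨ w ≠ 0) :
    u ^ 2 + p * w ^ 2 ≠ 0 := by
  intro he
  refine norm_sq_ne_norm_prime_mul_sq h ?_
  rw [eq_neg_of_add_eq_zero_left he, norm_neg]

theorem norm_le_one_of_norm_sq_add_le_one {u w : ℚ_[p]} (h : ‖u ^ 2 + p * w ^ 2‖ ≤ 1) :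
    ‖u‖ ≤ 1 ∧ ‖w‖ ≤ 1 := by
  by_cases h0 : u ≠ 0 ∨ w ≠ 0
  · rw [Padic.add_eq_max_of_ne (norm_sq_ne_norm_prime_mul_sq h0), max_le_iff, norm_pow, norm_mul,
      norm_pow, Padic.norm_p] at h
    have hp1 : (1 : ℝ) < p := by exact_mod_cast hp.1.one_lt
    refine ⟨(pow_le_one_iff_of_nonneg (norm_nonneg _) two_ne_zero).1 h.1, ?_⟩
    by_contra! hw
    have hw0 : w ≠ 0 := by
      rintro rfl
      simp at hw
      linarith
    have hwp : (p : ℝ) ≤ ‖w‖ := by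
      rw [Padic.norm_eq_zpow_neg_valuation hw0] at hw ⊢
      have := (one_lt_zpow_iff_right₀ hp1).1 hw
      calc (p : ℝ) = (p : ℝ) ^ (1 : ℤ) := (zpow_one _).symm
        _ ≤ _ := zpow_le_zpow_right₀ hp1.le (by omega)
    have h2 := h.2
    rw [inv_mul_le_iff₀ (by positivity)] at h2
    nlinarith
  · push Not at h0
    simp [h0.1, h0.2]

/-- A representation of -q would have integral u and w. Reduction modulo 8 refutes it for p = 2, and
reduction modulo p does so for odd p. -/
theorem IsAuxPair.sq_add_prime_mul_sq_ne {q : ℕ} (h : IsAuxPair p q) (u w : ℚ_[p]) :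
    u ^ 2 + p * w ^ 2 ≠ -(q : ℚ_[p]) := by
  intro he
  have hn : ‖u ^ 2 + p * w ^ 2‖ ≤ 1 := by
    rw [he, norm_neg]
    exact_mod_cast Padic.norm_int_le_one (p := p) (q : ℤ)
  obtain ⟨hu, hw⟩ := norm_le_one_of_norm_sq_add_le_one hn
  obtain ⟨u, rfl⟩ : ∃ u' : ℤ_[p], (u' : ℚ_[p]) = u := ⟨⟨u, hu⟩, rfl⟩
  obtain ⟨w, rfl⟩ : ∃ w' : ℤ_[p], (w' : ℚ_[p]) = w := ⟨⟨w, hw⟩, rfl⟩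
  have he' : u ^ 2 + p * w ^ 2 = -(q : ℤ_[p]) :=
    Subtype.ext (by push_cast; exact he)
  rcases h with ⟨rfl, rfl⟩ | ⟨-, -, -, -, hq⟩
  · have := congrArg (PadicInt.toZModPow (p := 2) 3) he'
    simp only [map_add, map_mul, map_pow, map_natCast, map_neg] at this
    generalize PadicInt.toZModPow (p := 2) 3 u = a at this
    generalize PadicInt.toZModPow (p := 2) 3 w = b at this
    revert a b
    decide
  · rw [not_isSquare_neg_iff] at hq
    apply hq
    have := congrArg (PadicInt.toZMod (p := p)) he'
    simp only [map_add, map_mul, map_pow, map_natCast, map_neg, CharP.cast_eq_zero, zero_mul,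
      add_zero] at this
    exact ⟨_, by rw [← this, sq]⟩

theorem one_lt_norm_of_dvd_den {x : ℚ} (h : p ∣ x.den) : 1 < ‖(x : ℚ_[p])‖ := by
  have hd : ‖(x.den : ℚ_[p])‖ < 1 := Padic.norm_natCast_lt_one_iff.2 h
  have hn : ‖(x.num : ℚ_[p])‖ = 1 := by
    refine le_antisymm (Padic.norm_int_le_one _) ?_
    by_contra! hlt
    rw [Padic.norm_intCast_lt_one_iff] at hlt
    have hc := x.reduced
    exact Nat.Prime.not_coprime_iff_dvd.2 ⟨p, hp.1, Int.natCast_dvd.1 hlt, h⟩ hc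
  have hx : (x : ℚ_[p]) * x.den = x.num := by exact_mod_cast Rat.mul_den_eq_num x
  rw [← hx, norm_mul] at hn
  nlinarith [norm_nonneg (x : ℚ_[p]), norm_nonneg (x.den : ℚ_[p])]

/-- With X⁻¹ = pv the left side equals -p(pX³)²(1 - p(8 + p²v⁶)), and Hensel's lemma makes the last
factor a square. The coefficient 8p - 1 and the sixth power serve the case p = 2, where the
correction must be divisible by 8. -/
theorem exists_eq_neg_prime_mul_sq {x : ℚ} (h : p ∣ x.den) :
    ∃ y : ℚ_[p], y ≠ 0 ∧ 1 + p ^ 3 * (8 * p - 1) * (x : ℚ_[p]) ^ 6 = -(p * y ^ 2) := by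
  have hx := one_lt_norm_of_dvd_den h
  set X := (x : ℚ_[p])
  have hX0 : X ≠ 0 := by
    intro h0
    rw [h0, norm_zero] at hx
    linarith
  obtain ⟨v, hv⟩ : ∃ v : ℤ_[p], X⁻¹ = p * v := by
    have hX1 : ‖X⁻¹‖ < 1 := by
      rw [norm_inv]
      exact inv_lt_one_of_one_lt₀ hx
    obtain ⟨v, hv⟩ := (PadicInt.norm_lt_one_iff_dvd (⟨X⁻¹, hX1.le⟩ : ℤ_[p])).1 hX1
    exact ⟨v, by simpa using congrArg (Subtype.val) hv⟩
  have hc : ‖-((p : ℤ_[p]) * (8 + p ^ 2 * v ^ 6))‖ < ‖(2 : ℤ_[p])‖ ^ 2 := by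
    have hp1 : ‖(p : ℤ_[p])‖ < 1 := by
      rw [PadicInt.norm_p]
      exact inv_lt_one_of_one_lt₀ (by exact_mod_cast hp.1.one_lt)
    rw [norm_neg, norm_mul]
    by_cases h2 : p = 2
    · subst h2
      have h1 : (8 + (2 : ℕ) ^ 2 * v ^ 6 : ℤ_[2]) = 2 ^ 2 * (2 + v ^ 6) := by push_cast; ring
      rw [h1, norm_mul, norm_pow]
      have h3 : 0 < ‖(2 : ℤ_[2])‖ := norm_pos_iff.2 two_ne_zero
      have h4 := PadicInt.norm_le_one (2 + v ^ 6)
      push_cast at hp1 ⊢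
      calc _ ≤ ‖(2 : ℤ_[2])‖ * (‖(2 : ℤ_[2])‖ ^ 2 * 1) := by gcongr
        _ < 1 * (‖(2 : ℤ_[2])‖ ^ 2 * 1) := by gcongr
        _ = _ := by ring
    · have h1 : ‖(2 : ℤ_[p])‖ = 1 := by
        have := PadicInt.norm_natCast_eq_one_iff (p := p) (n := 2)
        push_cast at this
        rw [this, Nat.coprime_primes hp.1 Nat.prime_two]
        exact h2
      rw [h1, one_pow]
      have := PadicInt.norm_le_one (8 + (p : ℤ_[p]) ^ 2 * v ^ 6)
      nlinarith [norm_nonneg (p : ℤ_[p])]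
  obtain ⟨w, hw⟩ := exists_sq_eq_one_add hc
  have hw' : (w : ℚ_[p]) ^ 2 = 1 + -((p : ℚ_[p]) * (8 + p ^ 2 * (v : ℚ_[p]) ^ 6)) := by
    exact_mod_cast congrArg (Subtype.val) hw
  have hp0 : (p : ℚ_[p]) ≠ 0 := by exact_mod_cast hp.1.ne_zero
  have hw0 : w ≠ 0 := by
    rintro rfl
    have h1 : -((p : ℤ_[p]) * (8 + p ^ 2 * v ^ 6)) = -1 := by linear_combination -hw
    rw [h1, norm_neg, norm_one] at hc
    have := PadicInt.norm_le_one (2 : ℤ_[p])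
    nlinarith [norm_nonneg (2 : ℤ_[p])]
  refine ⟨p * X ^ 3 * w, by simp [hp0, hX0, hw0], ?_⟩
  have hXv : X * (p * v) = 1 := by rw [← hv, mul_inv_cancel₀ hX0]
  have hXv6 : X ^ 6 * (p ^ 6 * (v : ℚ_[p]) ^ 6) = 1 := by
    rw [← mul_pow, ← mul_pow, hXv, one_pow]
  linear_combination p ^ 3 * X ^ 6 * hw' - hXv6

theorem IsAuxPair.not_dvd_den {q : ℕ} (h : IsAuxPair p q) {x d r s r' s' : ℚ}
    (h1 : 1 + p ^ 3 * (8 * p - 1) * x ^ 6 = r ^ 2 + d * s ^ 2)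
    (h2 : q * d = r' ^ 2 + p * s' ^ 2) : ¬ p ∣ x.den := by
  intro hx
  obtain ⟨y, hy, hxy⟩ := exists_eq_neg_prime_mul_sq hx
  have h1' : 1 + p ^ 3 * (8 * p - 1) * (x : ℚ_[p]) ^ 6 = (r : ℚ_[p]) ^ 2 + d * (s : ℚ_[p]) ^ 2 := by
    exact_mod_cast congrArg (Rat.cast : ℚ → ℚ_[p]) h1
  have h2' : q * d = (r' : ℚ_[p]) ^ 2 + p * (s' : ℚ_[p]) ^ 2 := by
    exact_mod_cast congrArg (Rat.cast : ℚ → ℚ_[p]) h2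
  rw [hxy] at h1'
  have hN := sq_add_prime_mul_sq_ne_zero (p := p) (u := (r : ℚ_[p])) (w := y) (Or.inr hy)
  have h3 : (r : ℚ_[p]) ^ 2 + p * y ^ 2 = -(d * (s : ℚ_[p]) ^ 2) := by linear_combination -h1'
  -- Up to conjugation these are the coordinates of s(r' + s'√-p)/(r + y√-p). Its norm is
  -- qds²/(-ds²) = -q.
  refine h.sq_add_prime_mul_sq_ne (s * (r' * r + p * s' * y) / (r ^ 2 + p * y ^ 2))
    (s * (r' * y - s' * r) / (r ^ 2 + p * y ^ 2)) ?_
  field_simp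
  linear_combination (-(s : ℚ_[p]) ^ 2 * ((r : ℚ_[p]) ^ 2 + p * y ^ 2)) * h2'
    + q * ((r : ℚ_[p]) ^ 2 + p * y ^ 2) * h3

end Padic

theorem IsAuxPair.not_dvd_den_iff {p q : ℕ} (h : IsAuxPair p q) (x : ℚ) :
    ¬ p ∣ x.den ↔ ∃ d r s r' s' : ℚ, 1 + p ^ 3 * (8 * p - 1) * x ^ 6 = r ^ 2 + d * s ^ 2 ∧
      q * d = r' ^ 2 + p * s' ^ 2 := by
  have := Fact.mk h.prime
  exact ⟨h.exists_conics, fun ⟨_, _, _, _, _, h1, h2⟩ => h.not_dvd_den h1 h2⟩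

/-! ### Primitive recursive access to coefficients and exponents -/

section Coding

open MvPolynomial

theorem le_add_sum_of_mem_raise {l : List ℕ} {s a : ℕ} (h : a ∈ Denumerable.raise l s) :
    a ≤ s + l.sum := by
  induction l generalizing s with
  | nil => simp [Denumerable.raise] at h
  | cons m l ih =>
    rw [Denumerable.raise, List.mem_cons] at h
    rw [List.sum_cons]
    rcases h with rfl | h
    · omega
    · have := ih h
      omega

theorem sum_le_encode (l : List ℕ) : l.sum ≤ Encodable.encode l := by
  induction l with
  | nil => simp
  | cons m l ih =>
    rw [List.sum_cons, Encodable.encode_list_cons]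
    have := Nat.add_le_pair (Encodable.encode m) (Encodable.encode l)
    simp only [Encodable.encode_nat] at this ⊢
    omega

/-- The exponent of `Xᵢ` in the `k`-th monomial. -/
noncomputable def exponent (k i : ℕ) : ℕ := monomialEquiv k i

/-- The variables in a monomial are bounded by its code. The same bound applies to the monomials of
a polynomial, so checks on codes need only bounded quantifiers. -/
theorem exponent_eq_zero_of_lt {k i : ℕ} (h : k < i) : exponent k i = 0 := by
  rw [exponent, monomialEquiv_apply, Multiset.coe_count, List.count_eq_zero]
  intro hi
  have h1 := le_add_sum_of_mem_raise hi
  have h2 := sum_le_encode (Denumerable.ofNat (List ℕ) k)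
  rw [Denumerable.encode_ofNat] at h2
  omega

/-- `Denumerable.raise` lists partial sums, so one fold carrying the running sum and the count
suffices. -/
theorem foldl_count_raise (i : ℕ) (l : List ℕ) (s c : ℕ) :
    l.foldl (fun (v : ℕ × ℕ) m => (v.1 + m, if v.1 + m = i then v.2 + 1 else v.2)) (s, c) =
      (s + l.sum, c + (Denumerable.raise l s).count i) := by
  induction l generalizing s c with
  | nil => simp [Denumerable.raise]
  | cons m l ih =>
    rw [List.foldl_cons, ih, Denumerable.raise, List.count_cons, List.sum_cons, add_comm m s]
    by_cases h : s + m = i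
    · simp [h]
      omega
    · simp [h]
      omega

theorem primrec_exponent : Primrec₂ exponent := by
  have h : Primrec₂ fun k i : ℕ =>
      ((Denumerable.ofNat (List ℕ) k).foldl
        (fun (v : ℕ × ℕ) m => (v.1 + m, if v.1 + m = i then v.2 + 1 else v.2)) (0, 0)).2 := by
    refine Primrec.snd.comp ?_
    refine Primrec.list_foldl (α := ℕ × ℕ) (β := ℕ) (σ := ℕ × ℕ)
      (f := fun a => Denumerable.ofNat (List ℕ) a.1) (g := fun _ => (0, 0))
      (h := fun a w => (w.1.1 + w.2, if w.1.1 + w.2 = a.2 then w.1.2 + 1 else w.1.2))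
      ((Primrec.ofNat (List ℕ)).comp Primrec.fst) (Primrec.const _) ?_
    have hs : Primrec fun u : (ℕ × ℕ) × ((ℕ × ℕ) × ℕ) => u.2.1.1 + u.2.2 :=
      Primrec.nat_add.comp (Primrec.fst.comp (Primrec.fst.comp Primrec.snd))
        (Primrec.snd.comp Primrec.snd)
    have hc : Primrec fun u : (ℕ × ℕ) × ((ℕ × ℕ) × ℕ) => u.2.1.2 :=
      Primrec.snd.comp (Primrec.fst.comp Primrec.snd)
    exact hs.pair (Primrec.ite (Primrec.eq.comp hs (Primrec.snd.comp Primrec.fst))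
      (Primrec.succ.comp hc) hc)
  refine h.of_eq fun k i => ?_
  rw [foldl_count_raise, exponent, monomialEquiv_apply, Multiset.coe_count]
  simp

/-- The positive part of the integer with code `m`. -/
def posPart (m : ℕ) : ℕ := if m % 2 = 0 then m / 2 else 0

/-- The negative part of the integer with code `m`. -/
def negPart (m : ℕ) : ℕ := if m % 2 = 0 then 0 else m / 2 + 1

theorem intEquivNat_symm_eq (m : ℕ) :
    Equiv.intEquivNat.symm m = (posPart m : ℤ) - negPart m := by
  rw [Equiv.symm_apply_eq]
  rcases Nat.even_or_odd' m with ⟨k, rfl | rfl⟩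
  · have : (2 * k) / 2 = k := by omega
    simp only [posPart, negPart, Nat.mul_mod_right, if_true, this]
    rw [Nat.cast_zero, sub_zero]
    exact (Nat.bit_false_apply k).symm
  · have h1 : (2 * k + 1) % 2 = 1 := by omega
    have h2 : (2 * k + 1) / 2 = k := by omega
    simp only [posPart, negPart, h1, h2, one_ne_zero, if_false]
    have : ((0 : ℕ) : ℤ) - (k + 1 : ℕ) = Int.negSucc k := by
      rw [Int.negSucc_eq]; push_cast; ring
    rw [this]
    exact (Nat.bit_true_apply k).symm

theorem primrec_posPart : Primrec posPart :=
  Primrec.ite (Primrec.eq.comp (Primrec.nat_mod.comp .id (.const 2)) (.const 0))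
    (Primrec.nat_div.comp .id (.const 2)) (.const 0)

theorem primrec_negPart : Primrec negPart :=
  Primrec.ite (Primrec.eq.comp (Primrec.nat_mod.comp .id (.const 2)) (.const 0))
    (.const 0) (Primrec.succ.comp (Primrec.nat_div.comp .id (.const 2)))

/-- The positive part of the coefficient of the `k`-th monomial in the `n`-th polynomial. -/
noncomputable def coeffPos (n k : ℕ) : ℕ := posPart (exponent n k)

/-- The negative part of the coefficient of the `k`-th monomial in the `n`-th polynomial. -/
noncomputable def coeffNeg (n k : ℕ) : ℕ := negPart (exponent n k)

theorem primrec_coeffPos : Primrec₂ coeffPos := primrec_posPart.comp₂ primrec_exponent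

theorem primrec_coeffNeg : Primrec₂ coeffNeg := primrec_negPart.comp₂ primrec_exponent

/-- Two natural parts let coefficient identities be tested over ℕ, with negative parts moved across
the equation. -/
theorem coeff_polyEquiv_eq_sub (n k : ℕ) :
    (polyEquiv n).coeff (monomialEquiv k) = (coeffPos n k : ℤ) - coeffNeg n k := by
  rw [coeff_polyEquiv, intEquivNat_symm_eq]; rfl

theorem coeffPos_eq_zero_of_lt {n k : ℕ} (h : n < k) : coeffPos n k = 0 := by
  rw [coeffPos, exponent_eq_zero_of_lt h]; rfl

theorem coeffNeg_eq_zero_of_lt {n k : ℕ} (h : n < k) : coeffNeg n k = 0 := by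
  rw [coeffNeg, exponent_eq_zero_of_lt h]; rfl

theorem polyEquiv_ext_iff {n : ℕ} {f : MvPolynomial ℕ ℤ} :
    n = polyEquiv.symm f ↔
      ∀ k, (coeffPos n k : ℤ) - coeffNeg n k = f.coeff (monomialEquiv k) := by
  rw [Equiv.eq_symm_apply, MvPolynomial.ext_iff, monomialEquiv.surjective.forall]
  simp only [coeff_polyEquiv_eq_sub]

theorem polyEquiv_eq_sum (n : ℕ) :
    polyEquiv n = ∑ k ∈ Finset.range (n + 1),
      monomial (monomialEquiv k) ((coeffPos n k : ℤ) - coeffNeg n k) := by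
  rw [MvPolynomial.ext_iff, monomialEquiv.surjective.forall]
  intro j
  rw [coeff_polyEquiv_eq_sub, coeff_sum]
  simp only [coeff_monomial, monomialEquiv.injective.eq_iff]
  rw [Finset.sum_ite_eq']
  split_ifs with h
  · rfl
  · have h : n < j := by simpa using h
    rw [coeffPos_eq_zero_of_lt h, coeffNeg_eq_zero_of_lt h]; rfl

theorem aeval_polyEquiv_congr {n : ℕ} {x y : ℕ → ℚ} (h : ∀ i ≤ n, x i = y i) :
    aeval x (polyEquiv n) = aeval y (polyEquiv n) := by
  rw [polyEquiv_eq_sum, map_sum, map_sum]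
  refine Finset.sum_congr rfl fun k hk => ?_
  rw [aeval_monomial, aeval_monomial]
  congr 1
  refine Finsupp.prod_congr fun i hi => ?_
  rw [h i]
  by_contra! hlt
  have hk' : k ≤ n := by simpa [Nat.lt_succ_iff] using hk
  exact Finsupp.mem_support_iff.1 hi (exponent_eq_zero_of_lt (hk'.trans_lt hlt))

end Coding

/-! ### Computability of polynomial arithmetic -/

section Computability

open MvPolynomial

noncomputable instance : Primcodable (MvPolynomial ℕ ℤ) := Primcodable.ofEquiv ℕ polyEquiv.symm

variable {α β : Type*} [Primcodable α] [Primcodable β]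

theorem primrec_polyEquiv : Primrec polyEquiv := Primrec.of_equiv_symm (e := polyEquiv.symm)

theorem primrec_polyEquiv_symm : Primrec polyEquiv.symm :=
  Primrec.of_equiv (e := polyEquiv.symm)

/-- An unbounded search for the value; it spares any explicit construction of codes. -/
theorem computable_of_graph {g : α → ℕ} {R : α → ℕ → Prop} (hR : PrimrecRel R)
    (h : ∀ a n, R a n ↔ n = g a) : Computable g := by
  classical
  have hp : Partrec fun a => Nat.rfindOpt fun n => if R a n then some n else none :=
    Partrec.rfindOpt (Primrec.to_comp
      (Primrec.ite hR (Primrec.option_some.comp Primrec.snd) (Primrec.const none)))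
  refine hp.of_eq_tot fun a => ?_
  obtain ⟨v, hv⟩ := Part.dom_iff_mem.1 (Nat.rfindOpt_dom.2
    ⟨g a, g a, by simp [(h a (g a)).2 rfl]⟩ :
      (Nat.rfindOpt fun n => if R a n then some n else none).Dom)
  obtain ⟨n, hn⟩ := Nat.rfindOpt_spec hv
  by_cases hR' : R a n
  · simp only [hR', if_true, Option.mem_def, Option.some.injEq] at hn
    rwa [← (h a n).1 hR', hn]
  · simp [hR'] at hn

theorem computable_poly_of_graph {g : α → MvPolynomial ℕ ℤ} {R : α → ℕ → Prop}
    (hR : PrimrecRel R) (h : ∀ a n, R a n ↔ n = polyEquiv.symm (g a)) : Computable g :=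
  (primrec_polyEquiv.to_comp.comp (computable_of_graph hR h)).of_eq fun a => by simp

theorem primrecRel_forall_lt {b : α → ℕ → ℕ} {R : α × ℕ → ℕ → Prop} (hb : Primrec₂ b)
    (hR : PrimrecRel R) : PrimrecRel fun a n => ∀ k < b a n, R (a, n) k :=
  ((PrimrecRel.forall_mem_list (R := fun k an => R an k) (hR.comp .snd .fst)).comp
    (Primrec.list_range.comp hb) .id).of_eq fun an => by simp

theorem computable_poly_add :
    Computable₂ fun f g : MvPolynomial ℕ ℤ => f + g := by
  let e : ℕ × ℕ → MvPolynomial ℕ ℤ := fun a => polyEquiv a.1 + polyEquiv a.2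
  have he : Computable e := by
    -- Beyond the bound a.1 + a.2 + n all three coefficients vanish, so comparing finitely many
    -- decides equality.
    refine computable_poly_of_graph (R := fun a n => ∀ k < a.1 + a.2 + n + 1,
      coeffPos n k + coeffNeg a.1 k + coeffNeg a.2 k =
        coeffPos a.1 k + coeffPos a.2 k + coeffNeg n k) ?_ ?_
    · refine primrecRel_forall_lt (α := ℕ × ℕ) (b := fun a n => a.1 + a.2 + n + 1)
        (R := fun a k => coeffPos a.2 k + coeffNeg a.1.1 k + coeffNeg a.1.2 k =
        coeffPos a.1.1 k + coeffPos a.1.2 k + coeffNeg a.2 k) ?_ ?_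
      · exact Primrec.succ.comp (Primrec.nat_add.comp (Primrec.nat_add.comp
          (Primrec.fst.comp .fst) (Primrec.snd.comp .fst)) .snd)
      · have h1 : Primrec fun u : ((ℕ × ℕ) × ℕ) × ℕ => u.1.1.1 :=
          Primrec.fst.comp (Primrec.fst.comp .fst)
        have h2 : Primrec fun u : ((ℕ × ℕ) × ℕ) × ℕ => u.1.1.2 :=
          Primrec.snd.comp (Primrec.fst.comp .fst)
        have h3 : Primrec fun u : ((ℕ × ℕ) × ℕ) × ℕ => u.1.2 := Primrec.snd.comp .fst
        have P := fun {i : ((ℕ × ℕ) × ℕ) × ℕ → ℕ} (hi : Primrec i) =>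
          primrec_coeffPos.comp hi Primrec.snd
        have N := fun {i : ((ℕ × ℕ) × ℕ) × ℕ → ℕ} (hi : Primrec i) =>
          primrec_coeffNeg.comp hi Primrec.snd
        exact Primrec.eq.comp
          (Primrec.nat_add.comp (Primrec.nat_add.comp (P h3) (N h1)) (N h2))
          (Primrec.nat_add.comp (Primrec.nat_add.comp (P h1) (P h2)) (N h3))
    · rintro ⟨a, b⟩ n
      rw [polyEquiv_ext_iff]
      simp only [e, coeff_add, coeff_polyEquiv_eq_sub]
      constructor
      · intro h k
        by_cases hk : k < a + b + n + 1
        · have := h k hk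
          omega
        · rw [coeffPos_eq_zero_of_lt (n := n) (by omega), coeffPos_eq_zero_of_lt (n := a) (by omega),
            coeffPos_eq_zero_of_lt (n := b) (by omega), coeffNeg_eq_zero_of_lt (n := n) (by omega),
            coeffNeg_eq_zero_of_lt (n := a) (by omega), coeffNeg_eq_zero_of_lt (n := b) (by omega)]
          rfl
      · intro h k _
        have := h k
        omega
  exact (he.comp ((primrec_polyEquiv_symm.to_comp.comp .fst).pair
    (primrec_polyEquiv_symm.to_comp.comp .snd))).of_eq fun a => by simp [e]

/-- The code of the product of two monomials. -/
noncomputable def monomialMul (i j : ℕ) : ℕ := monomialEquiv.symm (monomialEquiv i + monomialEquiv j)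

theorem monomialEquiv_ext_iff {k : ℕ} {m : ℕ →₀ ℕ} :
    k = monomialEquiv.symm m ↔ ∀ v, exponent k v = m v := by
  rw [Equiv.eq_symm_apply, Finsupp.ext_iff]; rfl

theorem computable_monomialMul : Computable₂ monomialMul := by
  refine computable_of_graph (α := ℕ × ℕ) (R := fun a n => ∀ k < a.1 + a.2 + n + 1,
    exponent n k = exponent a.1 k + exponent a.2 k) ?_ ?_
  · refine primrecRel_forall_lt (α := ℕ × ℕ) (b := fun a n => a.1 + a.2 + n + 1)
      (R := fun a k => exponent a.2 k = exponent a.1.1 k + exponent a.1.2 k) ?_ ?_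
    · exact Primrec.succ.comp (Primrec.nat_add.comp (Primrec.nat_add.comp
        (Primrec.fst.comp .fst) (Primrec.snd.comp .fst)) .snd)
    · have E := fun {i : ((ℕ × ℕ) × ℕ) × ℕ → ℕ} (hi : Primrec i) =>
        primrec_exponent.comp hi Primrec.snd
      exact Primrec.eq.comp (E (Primrec.snd.comp .fst))
        (Primrec.nat_add.comp (E (Primrec.fst.comp (Primrec.fst.comp .fst)))
          (E (Primrec.snd.comp (Primrec.fst.comp .fst))))
  · rintro ⟨a, b⟩ n
    rw [monomialMul, monomialEquiv_ext_iff]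
    simp only [Finsupp.add_apply]
    constructor
    · intro h k
      by_cases hk : k < a + b + n + 1
      · exact h k hk
      · rw [exponent_eq_zero_of_lt (k := n) (by omega)]
        change 0 = exponent a k + exponent b k
        rw [exponent_eq_zero_of_lt (k := a) (by omega), exponent_eq_zero_of_lt (k := b) (by omega)]
    · intro h k _
      exact h k

theorem computable_monomialEquiv_symm_single :
    Computable fun i : ℕ => monomialEquiv.symm (Finsupp.single i 1) := by
  refine computable_of_graph (R := fun i n => ∀ k < i + n + 1,
    exponent n k = if k = i then 1 else 0) ?_ ?_
  · refine primrecRel_forall_lt (α := ℕ) (b := fun i n => i + n + 1)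
      (R := fun a k => exponent a.2 k = if k = a.1 then 1 else 0) ?_ ?_
    · exact Primrec.succ.comp Primrec.nat_add
    · exact Primrec.eq.comp (primrec_exponent.comp (Primrec.snd.comp .fst) .snd)
        (Primrec.ite (Primrec.eq.comp .snd (Primrec.fst.comp .fst)) (.const 1) (.const 0))
  · intro i n
    rw [monomialEquiv_ext_iff]
    simp only [Finsupp.single_apply, eq_comm (a := i)]
    constructor
    · intro h k
      by_cases hk : k < i + n + 1
      · exact h k hk
      · rw [exponent_eq_zero_of_lt (k := n) (by omega), if_neg (by omega)]
    · intro h k _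
      exact h k

/-- The `a.1`-th monomial with coefficient `a.2.1 - a.2.2`. -/
noncomputable def codedTerm (a : ℕ × ℕ × ℕ) : MvPolynomial ℕ ℤ :=
  monomial (monomialEquiv a.1) ((a.2.1 : ℤ) - a.2.2)

theorem computable_codedTerm : Computable codedTerm := by
  refine computable_poly_of_graph (R := fun a n => ∀ k < a.1 + n + 1,
      coeffPos n k + (if k = a.1 then a.2.2 else 0) =
        (if k = a.1 then a.2.1 else 0) + coeffNeg n k) ?_ ?_
  · refine primrecRel_forall_lt (α := ℕ × ℕ × ℕ) (b := fun a n => a.1 + n + 1)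
      (R := fun a k => coeffPos a.2 k + (if k = a.1.1 then a.1.2.2 else 0) =
        (if k = a.1.1 then a.1.2.1 else 0) + coeffNeg a.2 k) ?_ ?_
    · exact Primrec.succ.comp (Primrec.nat_add.comp (Primrec.fst.comp .fst) .snd)
    · have hd : PrimrecPred fun u : ((ℕ × ℕ × ℕ) × ℕ) × ℕ => u.2 = u.1.1.1 :=
        Primrec.eq.comp .snd (Primrec.fst.comp (Primrec.fst.comp .fst))
      have h2 : Primrec fun u : ((ℕ × ℕ × ℕ) × ℕ) × ℕ => u.1.1.2 :=
        Primrec.snd.comp (Primrec.fst.comp .fst)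
      exact Primrec.eq.comp
        (Primrec.nat_add.comp (primrec_coeffPos.comp (Primrec.snd.comp .fst) .snd)
          (Primrec.ite hd (Primrec.snd.comp h2) (.const 0)))
        (Primrec.nat_add.comp (Primrec.ite hd (Primrec.fst.comp h2) (.const 0))
          (primrec_coeffNeg.comp (Primrec.snd.comp .fst) .snd))
  · rintro ⟨i, a, b⟩ n
    rw [polyEquiv_ext_iff]
    simp only [codedTerm, coeff_monomial, monomialEquiv.injective.eq_iff, eq_comm (a := i)]
    constructor
    · intro h k
      by_cases hk : k < i + n + 1
      · have := h k hk
        split_ifs at this ⊢ <;> omega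
      · rw [coeffPos_eq_zero_of_lt (n := n) (by omega), coeffNeg_eq_zero_of_lt (n := n) (by omega),
          if_neg (by omega)]
        rfl
    · intro h k _
      have := h k
      split_ifs at this ⊢ <;> omega

theorem computable_X : Computable (X : ℕ → MvPolynomial ℕ ℤ) := by
  refine (computable_codedTerm.comp (computable_monomialEquiv_symm_single.pair
    (Computable.const (1, 0)))).of_eq fun i => ?_
  simp [codedTerm, X]

theorem computable_poly_sum {m : α → ℕ} {F : α → ℕ → MvPolynomial ℕ ℤ} (hm : Computable m)
    (hF : Computable₂ F) : Computable fun a => ∑ i ∈ Finset.range (m a), F a i := by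
  refine (Computable.nat_rec (h := fun a w => w.2 + F a w.1) hm
    (Computable.const (0 : MvPolynomial ℕ ℤ)) ?_).of_eq fun a => ?_
  · exact computable_poly_add.comp (Computable.snd.comp .snd)
      (hF.comp .fst (Computable.fst.comp .snd))
  · induction m a with
    | zero => simp
    | succ n ih => rw [Finset.sum_range_succ, ← ih]

/-- The product of the terms with indices `i` and `j` of two polynomials with given codes. -/
noncomputable def termMul (a : ℕ × ℕ) (i j : ℕ) : MvPolynomial ℕ ℤ :=
  codedTerm (monomialMul i j,
    coeffPos a.1 i * coeffPos a.2 j + coeffNeg a.1 i * coeffNeg a.2 j,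
    coeffPos a.1 i * coeffNeg a.2 j + coeffNeg a.1 i * coeffPos a.2 j)

theorem computable_termMul : Computable fun u : ((ℕ × ℕ) × ℕ) × ℕ => termMul u.1.1 u.1.2 u.2 := by
  have h1 : Primrec fun u : ((ℕ × ℕ) × ℕ) × ℕ => u.1.1.1 :=
    Primrec.fst.comp (Primrec.fst.comp .fst)
  have h2 : Primrec fun u : ((ℕ × ℕ) × ℕ) × ℕ => u.1.1.2 :=
    Primrec.snd.comp (Primrec.fst.comp .fst)
  have hi : Primrec fun u : ((ℕ × ℕ) × ℕ) × ℕ => u.1.2 := Primrec.snd.comp .fst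
  have P1 := primrec_coeffPos.comp h1 hi
  have N1 := primrec_coeffNeg.comp h1 hi
  have P2 := primrec_coeffPos.comp h2 Primrec.snd
  have N2 := primrec_coeffNeg.comp h2 Primrec.snd
  have hc := (Primrec.nat_add.comp (Primrec.nat_mul.comp P1 P2) (Primrec.nat_mul.comp N1 N2)).pair
    (Primrec.nat_add.comp (Primrec.nat_mul.comp P1 N2) (Primrec.nat_mul.comp N1 P2))
  exact computable_codedTerm.comp
    ((computable_monomialMul.comp hi.to_comp Computable.snd).pair hc.to_comp)

theorem polyEquiv_mul_polyEquiv (a : ℕ × ℕ) :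
    polyEquiv a.1 * polyEquiv a.2 =
      ∑ i ∈ Finset.range (a.1 + 1), ∑ j ∈ Finset.range (a.2 + 1), termMul a i j := by
  conv_lhs => rw [polyEquiv_eq_sum a.1, polyEquiv_eq_sum a.2, Finset.sum_mul_sum]
  refine Finset.sum_congr rfl fun i _ => Finset.sum_congr rfl fun j _ => ?_
  rw [monomial_mul, termMul, codedTerm, monomialMul, Equiv.apply_symm_apply]
  congr 1
  push_cast
  ring

theorem computable_poly_mul :
    Computable₂ fun f g : MvPolynomial ℕ ℤ => f * g := by
  have h1 : Computable₂ fun (a : ℕ × ℕ) i => ∑ j ∈ Finset.range (a.2 + 1), termMul a i j :=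
    computable_poly_sum (α := (ℕ × ℕ) × ℕ) (m := fun a => a.1.2 + 1)
      (F := fun a j => termMul a.1 a.2 j)
      (Computable.succ.comp (Computable.snd.comp .fst)) computable_termMul
  have h2 := (computable_poly_sum (α := ℕ × ℕ) (m := fun a => a.1 + 1)
    (Computable.succ.comp .fst) h1).of_eq fun a => (polyEquiv_mul_polyEquiv a).symm
  exact (h2.comp ((primrec_polyEquiv_symm.to_comp.comp .fst).pair
    (primrec_polyEquiv_symm.to_comp.comp .snd))).of_eq fun a => by simp

theorem computable_poly_natCast : Computable (Nat.cast : ℕ → MvPolynomial ℕ ℤ) := by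
  refine (computable_poly_sum (F := fun _ _ => 1) Computable.id (Computable.const 1)).of_eq
    fun n => ?_
  simp

end Computability

/-! ### Semilocal solvability as a question about HTP(ℚ) -/

section Reduction

open MvPolynomial

variable {α : Type*} [Primcodable α]

theorem mem_HTP_rat_iff {f : MvPolynomial ℕ ℤ} : f ∈ HTP ℚ ↔ ∃ x : ℕ → ℚ, aeval x f = 0 :=
  Iff.rfl

theorem computable_poly_sub : Computable₂ fun f g : MvPolynomial ℕ ℤ => f - g :=
  (computable_poly_add.comp .fst (computable_poly_mul.comp (Computable.const (-1)) .snd)).of_eq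
    fun a => by ring

theorem Computable.poly_pow {f : α → MvPolynomial ℕ ℤ} (hf : Computable f) (k : ℕ) :
    Computable fun a => f a ^ k := by
  induction k with
  | zero => exact (Computable.const 1).of_eq fun a => by simp
  | succ k ih => exact (computable_poly_mul.comp ih hf).of_eq fun a => by rw [pow_succ]

/-- The `l`-th auxiliary variable for the `i`-th variable and the auxiliary pair `w`. -/
def auxVar (n : ℕ) (w : ℕ × ℕ) (i l : ℕ) : ℕ :=
  n + 1 + Nat.pair (Nat.pair w.1 w.2) (Nat.pair i l)

/-- A polynomial whose rational zeros witness that the value of `Xᵢ` is integral at `w.1`. -/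
noncomputable def integralityPoly (n : ℕ) (w : ℕ × ℕ) (i : ℕ) : MvPolynomial ℕ ℤ :=
  (1 + (w.1 : MvPolynomial ℕ ℤ) ^ 3 * (8 * (w.1 : MvPolynomial ℕ ℤ) - 1) * X i ^ 6 -
    (X (auxVar n w i 1) ^ 2 + X (auxVar n w i 0) * X (auxVar n w i 2) ^ 2)) ^ 2 +
  ((w.2 : MvPolynomial ℕ ℤ) * X (auxVar n w i 0) -
    (X (auxVar n w i 3) ^ 2 + (w.1 : MvPolynomial ℕ ℤ) * X (auxVar n w i 4) ^ 2)) ^ 2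

theorem aeval_integralityPoly_eq_zero_iff {n : ℕ} {w : ℕ × ℕ} {i : ℕ} {x : ℕ → ℚ} :
    aeval x (integralityPoly n w i) = 0 ↔
      1 + w.1 ^ 3 * (8 * w.1 - 1) * x i ^ 6 =
        x (auxVar n w i 1) ^ 2 + x (auxVar n w i 0) * x (auxVar n w i 2) ^ 2 ∧
      w.2 * x (auxVar n w i 0) = x (auxVar n w i 3) ^ 2 + w.1 * x (auxVar n w i 4) ^ 2 := by
  have h8 : aeval x (8 : MvPolynomial ℕ ℤ) = 8 := map_ofNat _ 8
  simp only [integralityPoly, map_add, map_sub, map_mul, map_pow, map_one, map_natCast, aeval_X,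
    h8]
  rw [add_eq_zero_iff_of_nonneg (sq_nonneg _) (sq_nonneg _), sq_eq_zero_iff, sq_eq_zero_iff,
    sub_eq_zero, sub_eq_zero]

theorem aeval_integralityPoly_nonneg (n : ℕ) (w : ℕ × ℕ) (i : ℕ) (x : ℕ → ℚ) :
    0 ≤ aeval x (integralityPoly n w i) := by
  simp only [integralityPoly, map_add, map_pow]
  positivity

theorem Computable.auxVar {n : α → ℕ} {w : α → ℕ × ℕ} {i : α → ℕ} (hn : Computable n)
    (hw : Computable w) (hi : Computable i) (l : ℕ) :
    Computable fun a => auxVar (n a) (w a) (i a) l :=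
  (Primrec.nat_add.to_comp.comp (Computable.succ.comp hn)
    (Primrec₂.natPair.to_comp.comp
      (Primrec₂.natPair.to_comp.comp (Computable.fst.comp hw) (Computable.snd.comp hw))
      (Primrec₂.natPair.to_comp.comp hi (Computable.const l)))).of_eq fun _ => rfl

theorem Computable.integralityPoly {n : α → ℕ} {w : α → ℕ × ℕ} {i : α → ℕ} (hn : Computable n)
    (hw : Computable w) (hi : Computable i) :
    Computable fun a => integralityPoly (n a) (w a) (i a) := by
  have V := fun l => computable_X.comp (Computable.auxVar hn hw hi l)
  have hp := computable_poly_natCast.comp (Computable.fst.comp hw)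
  have hq := computable_poly_natCast.comp (Computable.snd.comp hw)
  have h1 := computable_poly_sub.comp
    (computable_poly_add.comp (Computable.const 1) (computable_poly_mul.comp
      (computable_poly_mul.comp (Computable.poly_pow hp 3)
        (computable_poly_sub.comp (computable_poly_mul.comp (Computable.const 8) hp)
          (Computable.const 1))) (Computable.poly_pow (computable_X.comp hi) 6)))
    (computable_poly_add.comp (Computable.poly_pow (V 1) 2)
      (computable_poly_mul.comp (V 0) (Computable.poly_pow (V 2) 2)))
  have h2 := computable_poly_sub.comp (computable_poly_mul.comp hq (V 0))
    (computable_poly_add.comp (Computable.poly_pow (V 3) 2)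
      (computable_poly_mul.comp hp (Computable.poly_pow (V 4) 2)))
  exact computable_poly_add.comp (Computable.poly_pow h1 2) (Computable.poly_pow h2 2)

/-- A polynomial with a rational zero if and only if the `n`-th polynomial has a rational zero
integral at the primes of the list `L` of auxiliary pairs. -/
noncomputable def semilocalPoly (n : ℕ) (L : List (ℕ × ℕ)) : MvPolynomial ℕ ℤ :=
  polyEquiv n ^ 2 + ∑ j ∈ Finset.range L.length, ∑ i ∈ Finset.range (n + 1),
    integralityPoly n (L.getD j (0, 0)) i

theorem computable_semilocalPoly : Computable₂ semilocalPoly := by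
  refine computable_poly_add.comp
    (Computable.poly_pow (primrec_polyEquiv.to_comp.comp .fst) 2) ?_
  refine computable_poly_sum (α := ℕ × List (ℕ × ℕ)) (m := fun a => a.2.length)
    (F := fun a j => ∑ i ∈ Finset.range (a.1 + 1), integralityPoly a.1 (a.2.getD j (0, 0)) i)
    (Computable.list_length.comp .snd) ?_
  exact computable_poly_sum (α := (ℕ × List (ℕ × ℕ)) × ℕ) (m := fun a => a.1.1 + 1)
    (F := fun a i => integralityPoly a.1.1 (a.1.2.getD a.2 (0, 0)) i)
    (Computable.succ.comp (Computable.fst.comp .fst))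
    (Computable.integralityPoly (Computable.fst.comp (Computable.fst.comp .fst))
      ((Primrec.list_getD (0, 0)).to_comp.comp
        (Computable.snd.comp (Computable.fst.comp .fst)) (Computable.snd.comp .fst)) .snd)

theorem aeval_semilocalPoly_eq_zero_iff {n : ℕ} {L : List (ℕ × ℕ)} {x : ℕ → ℚ} :
    aeval x (semilocalPoly n L) = 0 ↔ aeval x (polyEquiv n) = 0 ∧
      ∀ w ∈ L, ∀ i ≤ n, aeval x (integralityPoly n w i) = 0 := by
  have h0 := fun w i => aeval_integralityPoly_nonneg n w i x
  simp only [semilocalPoly, map_add, map_sum, map_pow]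
  rw [add_eq_zero_iff_of_nonneg (sq_nonneg _)
    (Finset.sum_nonneg fun _ _ => Finset.sum_nonneg fun _ _ => h0 _ _), sq_eq_zero_iff,
    Finset.sum_eq_zero_iff_of_nonneg fun _ _ => Finset.sum_nonneg fun _ _ => h0 _ _]
  simp only [Finset.sum_eq_zero_iff_of_nonneg fun _ _ => h0 _ _, Finset.mem_range, Nat.lt_succ_iff]
  refine and_congr_right fun _ => ⟨fun h w hw => ?_, fun h j hj => ?_⟩
  · obtain ⟨j, hj, rfl⟩ := List.getElem_of_mem hw
    have := h j hj
    rwa [List.getD_eq_getElem _ _ hj] at this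
  · rw [List.getD_eq_getElem _ _ hj]
    exact h _ (List.getElem_mem hj)

/-- The `n`-th polynomial has a rational zero that is integral at all primes of `L`. -/
def SemilocalSolvable (n : ℕ) (L : List (ℕ × ℕ)) : Prop :=
  ∃ x : ℕ → ℚ, aeval x (polyEquiv n) = 0 ∧ ∀ i, ∀ w ∈ L, ¬ w.1 ∣ (x i).den

theorem semilocalPoly_mem_HTP_iff {n : ℕ} {L : List (ℕ × ℕ)} (hL : ∀ w ∈ L, IsAuxPair w.1 w.2) :
    semilocalPoly n L ∈ HTP ℚ ↔ SemilocalSolvable n L := by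
  rw [mem_HTP_rat_iff]
  simp only [aeval_semilocalPoly_eq_zero_iff, aeval_integralityPoly_eq_zero_iff]
  constructor
  · rintro ⟨x, hx, h⟩
    -- Only X₀, …, Xₙ occur in the n-th polynomial; the remaining values are reset to 0 to be
    -- integral everywhere.
    refine ⟨fun i => if i ≤ n then x i else 0, ?_, fun i w hw => ?_⟩
    · rw [← hx]
      exact aeval_polyEquiv_congr fun i hi => if_pos hi
    · beta_reduce
      split_ifs with hi
      · obtain ⟨h1, h2⟩ := h w hw i hi
        exact ((hL w hw).not_dvd_den_iff _).2 ⟨_, _, _, _, _, h1, h2⟩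
      · simpa using (hL w hw).prime.one_lt.ne'
  · rintro ⟨x, hx, h⟩
    have hex : ∀ (w : ℕ × ℕ) (i : ℕ), ∃ v : ℕ → ℚ, w ∈ L →
        1 + w.1 ^ 3 * (8 * w.1 - 1) * x i ^ 6 = v 1 ^ 2 + v 0 * v 2 ^ 2 ∧
          w.2 * v 0 = v 3 ^ 2 + w.1 * v 4 ^ 2 := by
      intro w i
      by_cases hw : w ∈ L
      · obtain ⟨d, r, s, r', s', h1, h2⟩ := ((hL w hw).not_dvd_den_iff _).1 (h i w hw)
        exact ⟨fun l => [d, r, s, r', s'].getD l 0, fun _ => ⟨h1, h2⟩⟩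
      · exact ⟨0, fun hw' => absurd hw' hw⟩
    choose v hv using hex
    -- The pairing in `auxVar` is injective with values above n, so all local witnesses fit into one
    -- assignment.
    let y : ℕ → ℚ := fun k => if k ≤ n then x k else
      v (k - (n + 1)).unpair.1.unpair (k - (n + 1)).unpair.2.unpair.1
        (k - (n + 1)).unpair.2.unpair.2
    have hy : ∀ w i l, y (auxVar n w i l) = v w i l := by
      intro w i l
      have h1 : ¬ auxVar n w i l ≤ n := by rw [auxVar]; omega
      have h2 : auxVar n w i l - (n + 1) = Nat.pair (Nat.pair w.1 w.2) (Nat.pair i l) := by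
        rw [auxVar]; omega
      simp only [y, h1, if_false, h2, Nat.unpair_pair]
    have hyx : ∀ i ≤ n, y i = x i := fun i hi => if_pos hi
    refine ⟨y, by rw [← hx]; exact aeval_polyEquiv_congr hyx, fun w hw i hi => ?_⟩
    rw [hyx i hi]
    simp only [hy]
    exact hv w i hw

/-- A polynomial with a rational zero if and only if the rational numbers with denominator `a` and
the numerators listed in `c` are a zero of the `n`-th polynomial. -/
noncomputable def witnessPoly (n a : ℕ) (c : List (ℕ × ℕ)) : MvPolynomial ℕ ℤ :=
  polyEquiv n ^ 2 + ∑ i ∈ Finset.range (n + 1),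
    ((a : MvPolynomial ℕ ℤ) * X i -
      (((c.getD i (0, 0)).1 : MvPolynomial ℕ ℤ) - ((c.getD i (0, 0)).2 : MvPolynomial ℕ ℤ))) ^ 2

theorem computable_witnessPoly :
    Computable fun u : ℕ × ℕ × List (ℕ × ℕ) => witnessPoly u.1 u.2.1 u.2.2 := by
  refine computable_poly_add.comp
    (Computable.poly_pow (primrec_polyEquiv.to_comp.comp .fst) 2) ?_
  refine computable_poly_sum (α := ℕ × ℕ × List (ℕ × ℕ)) (m := fun u => u.1 + 1)
    (F := fun u i => ((u.2.1 : MvPolynomial ℕ ℤ) * X i -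
      (((u.2.2.getD i (0, 0)).1 : MvPolynomial ℕ ℤ) -
        ((u.2.2.getD i (0, 0)).2 : MvPolynomial ℕ ℤ))) ^ 2)
    (Computable.succ.comp .fst) ?_
  have hc : Computable fun v : (ℕ × ℕ × List (ℕ × ℕ)) × ℕ => v.1.2.2.getD v.2 (0, 0) :=
    (Primrec.list_getD (0, 0)).to_comp.comp
      (Computable.snd.comp (Computable.snd.comp .fst)) .snd
  exact Computable.poly_pow (computable_poly_sub.comp
    (computable_poly_mul.comp
      (computable_poly_natCast.comp (Computable.fst.comp (Computable.snd.comp .fst)))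
      (computable_X.comp .snd))
    (computable_poly_sub.comp (computable_poly_natCast.comp (Computable.fst.comp hc))
      (computable_poly_natCast.comp (Computable.snd.comp hc)))) 2

theorem witnessPoly_mem_HTP_iff {n a : ℕ} {c : List (ℕ × ℕ)} :
    witnessPoly n a c ∈ HTP ℚ ↔ ∃ x : ℕ → ℚ, aeval x (polyEquiv n) = 0 ∧
      ∀ i ≤ n, a * x i = (c.getD i (0, 0)).1 - (c.getD i (0, 0)).2 := by
  rw [mem_HTP_rat_iff]
  refine exists_congr fun x => ?_
  simp only [witnessPoly, map_add, map_sum, map_pow, map_sub, map_mul, map_natCast, aeval_X]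
  rw [add_eq_zero_iff_of_nonneg (sq_nonneg _) (Finset.sum_nonneg fun _ _ => sq_nonneg _),
    sq_eq_zero_iff, Finset.sum_eq_zero_iff_of_nonneg fun _ _ => sq_nonneg _]
  simp only [sq_eq_zero_iff, sub_eq_zero, Finset.mem_range, Nat.lt_succ_iff]

theorem exists_witnessPoly_mem_HTP {n a : ℕ} {x : ℕ → ℚ} (hx : aeval x (polyEquiv n) = 0)
    (ha : ∀ i ≤ n, (x i).den ∣ a) : ∃ c, witnessPoly n a c ∈ HTP ℚ := by
  let z : ℕ → ℤ := fun i => (x i).num * (a / (x i).den : ℕ)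
  refine ⟨(List.range (n + 1)).map fun i => ((z i).toNat, (-z i).toNat),
    witnessPoly_mem_HTP_iff.2 ⟨x, hx, fun i hi => ?_⟩⟩
  have hi' : i < ((List.range (n + 1)).map fun i => ((z i).toNat, (-z i).toNat)).length := by
    simpa [Nat.lt_succ_iff] using hi
  rw [List.getD_eq_getElem _ _ hi']
  simp only [List.getElem_map, List.getElem_range]
  have h1 : ((z i).toNat : ℚ) - ((-z i).toNat : ℚ) = z i := by
    exact_mod_cast congrArg (Int.cast : ℤ → ℚ) (Int.toNat_sub_toNat_neg (z i))
  have h2 : (z i : ℚ) = a * x i := by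
    obtain ⟨b, hb⟩ := ha i hi
    have hd : (x i).den ≠ 0 := (x i).den_nz
    simp only [z, hb, Nat.mul_div_cancel_left b (Nat.pos_of_ne_zero hd)]
    have := Rat.mul_den_eq_num (x i)
    push_cast
    rw [← this]
    ring
  rw [← h2, ← h1]

end Reduction

/-! ### Effective search and the use principle -/

section Oracle

open Encodable

/-- A function is computable if its values are found by an effective search for a witness. -/
theorem computable_of_search {σ : Type*} [Primcodable σ] {h : ℕ × σ →. ℕ} (hh : Partrec h)
    {D : ℕ → ℕ} (sound : ∀ x s, ∀ y ∈ h (x, s), y = D x) (complete : ∀ x, ∃ s, (h (x, s)).Dom) :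
    Computable D := by
  obtain ⟨c, hc⟩ := Nat.Partrec.Code.exists_code.1 hh
  -- Dovetailing: t codes a step bound together with a candidate witness.
  have hp : Partrec fun x : ℕ => Nat.rfindOpt fun t =>
      Nat.Partrec.Code.evaln t.unpair.1 c (Nat.pair x t.unpair.2) := by
    refine Partrec.rfindOpt (Nat.Partrec.Code.primrec_evaln.to_comp.comp
      (((Computable.fst.comp (Computable.unpair.comp .snd)).pair (Computable.const c)).pair
        (Primrec₂.natPair.to_comp.comp .fst (Computable.snd.comp (Computable.unpair.comp .snd)))))
  refine hp.of_eq_tot fun x => ?_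
  have hd : (Nat.rfindOpt fun t =>
      Nat.Partrec.Code.evaln t.unpair.1 c (Nat.pair x t.unpair.2)).Dom := by
    obtain ⟨s, hs⟩ := complete x
    obtain ⟨y, hy⟩ := Part.dom_iff_mem.1 hs
    have hy' : y ∈ c.eval (Nat.pair x (encode s)) := by
      rw [hc]
      simp [hy]
    obtain ⟨k, hk⟩ := Nat.Partrec.Code.evaln_complete.1 hy'
    exact Nat.rfindOpt_dom.2 ⟨Nat.pair k (encode s), y, by simpa using hk⟩
  obtain ⟨y, hy⟩ := Part.dom_iff_mem.1 hd
  obtain ⟨t, ht⟩ := Nat.rfindOpt_spec hy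
  have hy' := Nat.Partrec.Code.evaln_sound ht
  rw [hc] at hy'
  simp only [Part.mem_bind_iff, Part.mem_coe, Option.mem_def, Part.mem_map_iff] at hy'
  obtain ⟨⟨x', s⟩, hxs, y', hy', rfl⟩ := hy'
  simp only [Encodable.decode_prod_val, Nat.unpair_pair, decode_nat, Option.bind_some,
    Option.map_eq_some_iff, Prod.mk.injEq] at hxs
  obtain ⟨s', -, rfl, rfl⟩ := hxs
  rw [← sound _ _ _ hy']
  exact hy

open Classical in
/-- The list of the first `k` values of the characteristic function of `A`. -/
noncomputable def initialSegment (A : Set ℕ) (k : ℕ) : List Bool :=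
  (List.range k).map fun i => decide (i ∈ A)

theorem initialSegment_getElem? {A : Set ℕ} {k i : ℕ} {b : Bool} :
    (initialSegment A k)[i]? = some b ↔ i < k ∧ (b = true ↔ i ∈ A) := by
  classical
  rw [initialSegment, List.getElem?_map, Option.map_eq_some_iff]
  simp only [List.getElem?_eq_some_iff, List.length_range, List.getElem_range]
  constructor
  · rintro ⟨_, ⟨h, rfl⟩, rfl⟩
    exact ⟨h, by simp⟩
  · rintro ⟨h, hb⟩
    refine ⟨i, ⟨h, rfl⟩, ?_⟩
    rw [Bool.eq_iff_iff, hb, decide_eq_true_iff]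

/-- The partial function `f` is the limit along `s` of the partial recursive `Ψ (s k)`. -/
structure IsLimitAlong (s : ℕ → List Bool) (Ψ : List Bool → ℕ → Part ℕ) (f : ℕ → Part ℕ) : Prop where
  partrec : Partrec₂ Ψ
  mono : ∀ {k k' x y}, k ≤ k' → y ∈ Ψ (s k) x → y ∈ Ψ (s k') x
  mem_iff : ∀ {x y}, y ∈ f x ↔ ∃ k, y ∈ Ψ (s k) x

variable {s : ℕ → List Bool}

theorem isLimitAlong_of_computable {g : ℕ → ℕ} (hg : Computable g) :
    IsLimitAlong s (fun _ x => Part.some (g x)) (fun x => Part.some (g x)) where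
  partrec := (hg.comp Computable.snd).partrec
  mono _ h := h
  mem_iff := by simp

theorem IsLimitAlong.pair {Ψ Φ : List Bool → ℕ → Part ℕ} {f h : ℕ → Part ℕ} (hf : IsLimitAlong s Ψ f)
    (hh : IsLimitAlong s Φ h) :
    IsLimitAlong s (fun l x => (Ψ l x).bind fun a => (Φ l x).map fun b => Nat.pair a b)
      (fun n => Nat.pair <$> f n <*> h n) where
  partrec := by
    refine Partrec.bind hf.partrec (Partrec.map (Partrec.comp hh.partrec Computable.fst) ?_)
    exact Primrec₂.natPair.to_comp.comp (Computable.snd.comp .fst) .snd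
  mono hk hy := by
    simp only [Part.mem_bind_iff, Part.mem_map_iff] at hy ⊢
    obtain ⟨a, ha, b, hb, rfl⟩ := hy
    exact ⟨a, hf.mono hk ha, b, hh.mono hk hb, rfl⟩
  mem_iff := by
    intro x y
    simp only [Seq.seq, Functor.map, Part.mem_bind_iff, Part.mem_map_iff, hf.mem_iff, hh.mem_iff]
    constructor
    · rintro ⟨_, ⟨a, ⟨k, ha⟩, rfl⟩, b, ⟨k', hb⟩, rfl⟩
      exact ⟨max k k', a, hf.mono (le_max_left _ _) ha, b, hh.mono (le_max_right _ _) hb, rfl⟩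
    · rintro ⟨k, a, ha, b, hb, rfl⟩
      exact ⟨_, ⟨a, ⟨k, ha⟩, rfl⟩, b, ⟨k, hb⟩, rfl⟩

theorem IsLimitAlong.comp {Ψ Φ : List Bool → ℕ → Part ℕ} {f h : ℕ → Part ℕ} (hf : IsLimitAlong s Ψ f)
    (hh : IsLimitAlong s Φ h) :
    IsLimitAlong s (fun l x => (Φ l x).bind (Ψ l)) (fun n => h n >>= f) where
  partrec := Partrec.bind hh.partrec
    (Partrec.comp hf.partrec ((Computable.fst.comp .fst).pair .snd))
  mono hk hy := by
    rw [Part.mem_bind_iff] at hy ⊢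
    obtain ⟨a, ha, hy⟩ := hy
    exact ⟨a, hh.mono hk ha, hf.mono hk hy⟩
  mem_iff := by
    intro x y
    simp only [Part.bind_eq_bind, Part.mem_bind_iff, hf.mem_iff, hh.mem_iff]
    constructor
    · rintro ⟨a, ⟨k, ha⟩, k', hy⟩
      exact ⟨max k k', a, hh.mono (le_max_left _ _) ha, hf.mono (le_max_right _ _) hy⟩
    · rintro ⟨k, a, ha, hy⟩
      exact ⟨a, ⟨k, ha⟩, k, hy⟩

theorem IsLimitAlong.prec {Ψ Φ : List Bool → ℕ → Part ℕ} {f h : ℕ → Part ℕ} (hf : IsLimitAlong s Ψ f)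
    (hh : IsLimitAlong s Φ h) :
    IsLimitAlong s (fun l p => p.unpair.2.rec (Ψ l p.unpair.1) fun y IH => IH.bind fun i =>
        Φ l (Nat.pair p.unpair.1 (Nat.pair y i)))
      (fun p => let (a, n) := Nat.unpair p
        n.rec (f a) fun y IH => do
          let i ← IH
          h (Nat.pair a (Nat.pair y i))) where
  partrec := by
    refine Partrec.nat_rec (f := fun q : List Bool × ℕ => q.2.unpair.2)
      (g := fun q => Ψ q.1 q.2.unpair.1)
      (h := fun q w => Φ q.1 (Nat.pair q.2.unpair.1 (Nat.pair w.1 w.2)))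
      (Computable.snd.comp (Computable.unpair.comp .snd))
      (Partrec.comp hf.partrec (Computable.fst.pair
        (Computable.fst.comp (Computable.unpair.comp .snd)))) ?_
    exact Partrec.comp hh.partrec ((Computable.fst.comp .fst).pair
      (Primrec₂.natPair.to_comp.comp
        (Computable.fst.comp (Computable.unpair.comp (Computable.snd.comp .fst)))
        (Primrec₂.natPair.to_comp.comp (Computable.fst.comp .snd) (Computable.snd.comp .snd))))
  mono := by
    intro k k' x y hk
    generalize x.unpair.1 = a
    induction x.unpair.2 generalizing y with
    | zero => exact hf.mono hk
    | succ n ih =>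
      simp only [Part.mem_bind_iff]
      rintro ⟨i, hi, hy⟩
      exact ⟨i, ih hi, hh.mono hk hy⟩
  mem_iff := by
    intro x y
    dsimp only
    generalize x.unpair.1 = a
    have hmono : ∀ (n : ℕ) {k k' y : ℕ}, k ≤ k' →
        y ∈ (n.rec (Ψ (s k) a) fun y IH => IH.bind fun i => Φ (s k) (Nat.pair a (Nat.pair y i)) :
          Part ℕ) →
        y ∈ (n.rec (Ψ (s k') a) fun y IH => IH.bind fun i => Φ (s k') (Nat.pair a (Nat.pair y i)) :
          Part ℕ) := by
      intro n k k' y hk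
      induction n generalizing y with
      | zero => exact hf.mono hk
      | succ n ih =>
        simp only [Part.mem_bind_iff]
        rintro ⟨i, hi, hy⟩
        exact ⟨i, ih hi, hh.mono hk hy⟩
    induction x.unpair.2 generalizing y with
    | zero => exact hf.mem_iff
    | succ n ih =>
      simp only [Part.bind_eq_bind, Part.mem_bind_iff] at ih ⊢
      simp only [ih, hh.mem_iff]
      constructor
      · rintro ⟨i, ⟨k, hi⟩, k', hy⟩
        exact ⟨max k k', i, hmono n (le_max_left _ _) hi, hh.mono (le_max_right _ _) hy⟩
      · rintro ⟨k, i, hi, hy⟩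
        exact ⟨i, ⟨k, hi⟩, k, hy⟩

theorem mem_rfind_iff {p : ℕ → Part Bool} {n : ℕ} :
    n ∈ Nat.rfind p ↔ true ∈ p n ∧ ∀ m < n, false ∈ p m :=
  Nat.mem_rfind

theorem IsLimitAlong.rfind {Ψ : List Bool → ℕ → Part ℕ} {f : ℕ → Part ℕ} (hf : IsLimitAlong s Ψ f) :
    IsLimitAlong s
      (fun l a => Nat.rfind fun n => (fun m => decide (m = 0)) <$> Ψ l (Nat.pair a n))
      (fun a => Nat.rfind fun n => (fun m => decide (m = 0)) <$> f (Nat.pair a n)) where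
  partrec := by
    refine Partrec.rfind (p := fun (q : List Bool × ℕ) n =>
      (Ψ q.1 (Nat.pair q.2 n)).map fun m => decide (m = 0)) ?_
    refine Partrec.map (Partrec.comp hf.partrec ((Computable.fst.comp .fst).pair
      (Primrec₂.natPair.to_comp.comp (Computable.snd.comp .fst) .snd))) ?_
    exact (Primrec.to_comp (Primrec.eq.decide.comp Primrec.id (Primrec.const 0))).comp
      Computable.snd
  mono := by
    intro k k' x y hk
    simp only [mem_rfind_iff, Part.map_eq_map, Part.mem_map_iff]
    rintro ⟨⟨m, hm, h0⟩, h⟩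
    refine ⟨⟨m, hf.mono hk hm, h0⟩, fun j hj => ?_⟩
    obtain ⟨m, hm, h0⟩ := h j hj
    exact ⟨m, hf.mono hk hm, h0⟩
  mem_iff := by
    intro x y
    simp only [mem_rfind_iff, Part.map_eq_map, Part.mem_map_iff, hf.mem_iff]
    constructor
    · rintro ⟨⟨m, ⟨k, hm⟩, h0⟩, h⟩
      -- The finitely many values below y converge at different stages; monotonicity allows a common
      -- one.
      have hK : ∀ n ≤ y, ∃ K, ∀ j < n, ∃ a, a ∈ Ψ (s K) (Nat.pair x j) ∧ decide (a = 0) = false := by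
        intro n
        induction n with
        | zero => exact fun _ => ⟨0, fun j hj => absurd hj (Nat.not_lt_zero _)⟩
        | succ n ih =>
          intro hn
          obtain ⟨K, hK⟩ := ih (Nat.le_of_succ_le hn)
          obtain ⟨a, ⟨K', ha⟩, ha0⟩ := h n (Nat.lt_of_succ_le hn)
          refine ⟨max K K', fun j hj => ?_⟩
          rcases Nat.lt_succ_iff_lt_or_eq.1 hj with hj | rfl
          · obtain ⟨b, hb, hb0⟩ := hK j hj
            exact ⟨b, hf.mono (le_max_left _ _) hb, hb0⟩
          · exact ⟨a, hf.mono (le_max_right _ _) ha, ha0⟩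
      obtain ⟨K, hK⟩ := hK y le_rfl
      refine ⟨max k K, ⟨m, hf.mono (le_max_left _ _) hm, h0⟩, fun j hj => ?_⟩
      obtain ⟨b, hb, hb0⟩ := hK j hj
      exact ⟨b, hf.mono (le_max_right _ _) hb, hb0⟩
    · rintro ⟨k, ⟨m, hm, h0⟩, h⟩
      refine ⟨⟨m, ⟨k, hm⟩, h0⟩, fun j hj => ?_⟩
      obtain ⟨b, hb, hb0⟩ := h j hj
      exact ⟨b, ⟨k, hb⟩, hb0⟩

theorem isLimitAlong_chi (A : Set ℕ) :
    IsLimitAlong (initialSegment A)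
      (fun l x => ((l[x]?.map fun b => cond b 1 0 : Option ℕ) : Part ℕ)) (chi A) where
  partrec := by
    refine Computable.ofOption (Computable.option_map Computable.list_getElem? ?_)
    exact (Primrec.to_comp (Primrec.dom_bool fun b => cond b 1 0)).comp Computable.snd
  mono := by
    intro k k' x y hk
    simp only [Part.mem_coe, Option.mem_def, Option.map_eq_some_iff, initialSegment_getElem?]
    rintro ⟨b, ⟨hx, hb⟩, rfl⟩
    exact ⟨b, ⟨hx.trans_le hk, hb⟩, rfl⟩
  mem_iff := by
    classical
    intro x y
    simp only [Part.mem_coe, Option.mem_def, Option.map_eq_some_iff, initialSegment_getElem?, chi,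
      Part.mem_some_iff]
    constructor
    · rintro rfl
      refine ⟨x + 1, decide (x ∈ A), ⟨x.lt_succ_self, by simp⟩, ?_⟩
      by_cases hx : x ∈ A <;> simp [hx]
    · rintro ⟨k, b, ⟨-, hb⟩, rfl⟩
      by_cases hx : x ∈ A <;> cases b <;> simp_all

/-- Induction over the closure schemes: each halting computation combines finitely many halting
subcomputations, so a long enough initial segment of the oracle serves them all. -/
theorem exists_isLimitAlong {A : Set ℕ} {f : ℕ →. ℕ} (h : Nat.RecursiveIn {chi A} f) :
    ∃ Ψ, IsLimitAlong (initialSegment A) Ψ f := by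
  induction h with
  | zero => exact ⟨_, isLimitAlong_of_computable (Computable.const 0)⟩
  | succ => exact ⟨_, isLimitAlong_of_computable Computable.succ⟩
  | left => exact ⟨_, isLimitAlong_of_computable (Computable.fst.comp .unpair)⟩
  | right => exact ⟨_, isLimitAlong_of_computable (Computable.snd.comp .unpair)⟩
  | oracle g hg =>
    rw [Set.mem_singleton_iff.1 hg]
    exact ⟨_, isLimitAlong_chi A⟩
  | pair _ _ ihf ihh =>
    obtain ⟨Ψ, hΨ⟩ := ihf
    obtain ⟨Φ, hΦ⟩ := ihh
    exact ⟨_, hΨ.pair hΦ⟩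
  | comp _ _ ihf ihh =>
    obtain ⟨Ψ, hΨ⟩ := ihf
    obtain ⟨Φ, hΦ⟩ := ihh
    exact ⟨_, hΨ.comp hΦ⟩
  | prec _ _ ihf ihh =>
    obtain ⟨Ψ, hΨ⟩ := ihf
    obtain ⟨Φ, hΦ⟩ := ihh
    exact ⟨_, hΨ.prec hΦ⟩
  | rfind _ ih =>
    obtain ⟨Ψ, hΨ⟩ := ih
    exact ⟨_, hΨ.rfind⟩

/-- The use principle: a computation relative to `A` consults finitely many values of `A`. -/
theorem exists_code_of_setTuringLE {D A : Set ℕ} (h : SetTuringLE D A) :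
    ∃ c : Nat.Partrec.Code, ∀ x y, y ∈ chi D x ↔
      ∃ k, y ∈ c.eval (Nat.pair (encode (initialSegment A k)) x) := by
  obtain ⟨Ψ, hΨ⟩ := exists_isLimitAlong (RecursiveIn.iff_nat.1 h)
  obtain ⟨c, hc⟩ := Nat.Partrec.Code.exists_code.1 hΨ.partrec
  refine ⟨c, fun x y => ?_⟩
  rw [hΨ.mem_iff, hc]
  simp

/-- The program from the use principle determines D, and there are countably many programs. -/
theorem countable_setOf_setTuringLE (A : Set ℕ) : {D | SetTuringLE D A}.Countable := by
  classical
  choose! c hc using fun D (h : SetTuringLE D A) => exists_code_of_setTuringLE h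
  refine Set.countable_of_injective_of_countable_image (f := c) (fun D hD E hE hDE => ?_)
    (Set.to_countable _)
  ext x
  have h : ∀ y, y ∈ chi D x ↔ y ∈ chi E x := fun y => by rw [hc D hD, hc E hE, hDE]
  have h1 := h 1
  simp only [chi, Part.mem_some_iff] at h1
  by_cases hxD : x ∈ D <;> by_cases hxE : x ∈ E <;> simp_all

end Oracle

/-! ### Membership in R_W through denominators -/

section Subrings

open MvPolynomial

theorem mem_subringOf_iff {W : Set Nat.Primes} {x : ℚ} :
    x ∈ subringOf W ↔ ∀ p : Nat.Primes, (p : ℕ) ∣ x.den → p ∈ W := by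
  constructor
  · intro hx
    rw [subringOf] at hx
    induction hx using Subring.closure_induction with
    | mem x hx =>
      obtain ⟨q, hq, rfl⟩ := hx
      intro p hp
      rw [Rat.inv_natCast_den_of_pos q.2.pos, Nat.prime_dvd_prime_iff_eq p.2 q.2] at hp
      rwa [Nat.Primes.coe_nat_injective hp]
    | zero => intro p hp; exact absurd (Nat.dvd_one.1 hp) p.2.one_lt.ne'
    | one => intro p hp; exact absurd (Nat.dvd_one.1 hp) p.2.one_lt.ne'
    | add x y _ _ ihx ihy =>
      intro p hp
      exact (p.2.dvd_mul.1 (hp.trans (Rat.add_den_dvd x y))).elim (ihx p) (ihy p)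
    | neg x _ ih => simpa using ih
    | mul x y _ _ ihx ihy =>
      intro p hp
      exact (p.2.dvd_mul.1 (hp.trans (Rat.mul_den_dvd x y))).elim (ihx p) (ihy p)
  · intro h
    have hinv : ∀ n : ℕ, n ≠ 0 → (∀ p : Nat.Primes, (p : ℕ) ∣ n → p ∈ W) →
        (n : ℚ)⁻¹ ∈ subringOf W := by
      intro n
      induction n using Nat.recOnMul with
      | zero => intro h0; exact absurd rfl h0
      | one => intro _ _; simp
      | prime p hp =>
        intro _ hn
        exact Subring.subset_closure ⟨⟨p, hp⟩, hn ⟨p, hp⟩ dvd_rfl, rfl⟩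
      | mul a b iha ihb =>
        intro h0 hn
        rw [Nat.cast_mul, mul_inv]
        exact (subringOf W).mul_mem
          (iha (left_ne_zero_of_mul h0) fun p hp => hn p (hp.mul_right _))
          (ihb (right_ne_zero_of_mul h0) fun p hp => hn p (hp.mul_left _))
    rw [← Rat.num_div_den x, div_eq_mul_inv]
    exact (subringOf W).mul_mem (intCast_mem _ _) (hinv _ x.den_nz h)

theorem mem_HTPCode_subringOf_iff {W : Set Nat.Primes} {n : ℕ} :
    n ∈ HTPCode (subringOf W) ↔ ∃ x : ℕ → ℚ, aeval x (polyEquiv n) = 0 ∧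
      ∀ i, ∀ p : Nat.Primes, (p : ℕ) ∣ (x i).den → p ∈ W := by
  simp only [← mem_subringOf_iff]
  have key : ∀ y : ℕ → subringOf W,
      ((eval₂ (Int.castRingHom (subringOf W)) y (polyEquiv n) : subringOf W) : ℚ) =
        aeval (fun i => (y i : ℚ)) (polyEquiv n) := by
    intro y
    change (subringOf W).subtype _ = _
    rw [hom_eval₂, aeval_def]
    congr 1
  constructor
  · rintro ⟨y, hy⟩
    exact ⟨fun i => y i, by rw [← key, hy]; rfl, fun i => (y i).2⟩
  · rintro ⟨x, hx, h⟩
    refine ⟨fun i => ⟨x i, h i⟩, Subtype.ext ?_⟩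
    rw [key]
    exact hx

end Subrings

/-! ### Conditions, forcing and generic sets of primes -/

section Forcing

open MvPolynomial

/-- The sets of primes that contain all prime divisors of `a` and no first component of a pair
in `L`. -/
def cylinder (a : ℕ) (L : List (ℕ × ℕ)) : Set (Nat.Primes → Bool) :=
  {W | (∀ p : Nat.Primes, (p : ℕ) ∣ a → W p = true) ∧
    ∀ w ∈ L, ∀ p : Nat.Primes, (p : ℕ) = w.1 → W p = false}

theorem cylinder_mul_append {a b : ℕ} {L M : List (ℕ × ℕ)} :
    cylinder (a * b) (L ++ M) = cylinder a L ∩ cylinder b M := by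
  ext W
  simp only [cylinder, Set.mem_inter_iff, Set.mem_ofPred_eq, List.mem_append]
  constructor
  · rintro ⟨h1, h2⟩
    exact ⟨⟨fun p hp => h1 p (hp.mul_right _), fun w hw => h2 w (Or.inl hw)⟩,
      fun p hp => h1 p (hp.mul_left _), fun w hw => h2 w (Or.inr hw)⟩
  · rintro ⟨⟨h1, h2⟩, h3, h4⟩
    exact ⟨fun p hp => (p.2.dvd_mul.1 hp).elim (h1 p) (h3 p),
      fun w hw => hw.elim (h2 w) (h4 w)⟩

theorem isOpen_setOf_apply_eq (p : Nat.Primes) (b : Bool) :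
    IsOpen {W : Nat.Primes → Bool | W p = b} := by
  have h : {W : Nat.Primes → Bool | W p = b} = (fun W : Nat.Primes → Bool => W p) ⁻¹' {b} := by
    ext W
    simp
  rw [h]
  exact (isOpen_discrete {b}).preimage (continuous_apply p)

theorem isOpen_cylinder {a : ℕ} (ha : a ≠ 0) (L : List (ℕ × ℕ)) : IsOpen (cylinder a L) := by
  have hfin : ∀ n : ℕ, n ≠ 0 → {p : Nat.Primes | (p : ℕ) ∣ n}.Finite := fun n hn =>
    ((Set.finite_le_nat n).preimage (f := fun p : Nat.Primes => (p : ℕ))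
      Nat.Primes.coe_nat_injective.injOn).subset
        fun _ hp => Nat.le_of_dvd (Nat.pos_of_ne_zero hn) hp
  have h : cylinder a L = (⋂ p ∈ {p : Nat.Primes | (p : ℕ) ∣ a}, {W | W p = true}) ∩
      ⋂ w ∈ {w | w ∈ L}, ⋂ p ∈ {p : Nat.Primes | (p : ℕ) = w.1}, {W | W p = false} := by
    ext W
    simp [cylinder]
  rw [h]
  refine ((hfin a ha).isOpen_biInter fun p _ => isOpen_setOf_apply_eq p _).inter ?_
  refine L.finite_toSet.isOpen_biInter fun w _ => ?_
  refine Set.Finite.isOpen_biInter ?_ fun p _ => isOpen_setOf_apply_eq p _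
  exact Set.Subsingleton.finite fun p hp q hq => Nat.Primes.coe_nat_injective (hp.trans hq.symm)

/-- All members of the list are auxiliary pairs. -/
def IsAuxList (L : List (ℕ × ℕ)) : Prop := ∀ w ∈ L, IsAuxPair w.1 w.2

theorem IsAuxList.append {L M : List (ℕ × ℕ)} (hL : IsAuxList L) (hM : IsAuxList M) :
    IsAuxList (L ++ M) := fun w hw => (List.mem_append.1 hw).elim (hL w) (hM w)

theorem exists_cylinder_subset {U : Set (Nat.Primes → Bool)} (hU : IsOpen U)
    {W : Nat.Primes → Bool} (hW : W ∈ U) :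
    ∃ a L, a ≠ 0 ∧ IsAuxList L ∧ W ∈ cylinder a L ∧ cylinder a L ⊆ U := by
  classical
  obtain ⟨I, u, hu, hIU⟩ := isOpen_pi_iff.1 hU W hW
  -- The coordinates fixed to be true multiply to a; those fixed to be false enter L, each with an
  -- auxiliary number.
  choose q hq using fun p : Nat.Primes => exists_isAuxPair p.2
  refine ⟨∏ p ∈ I with W p = true, (p : ℕ),
    (I.filter fun p => W p = false).toList.map fun p : Nat.Primes => ((p : ℕ), q p), ?_, ?_, ⟨?_, ?_⟩, ?_⟩
  · exact Finset.prod_ne_zero_iff.2 fun p _ => p.2.ne_zero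
  · intro w hw
    obtain ⟨p, -, rfl⟩ := List.mem_map.1 hw
    exact hq p
  · intro p hp
    obtain ⟨r, hr, hpr⟩ := (Prime.dvd_finsetProd_iff (Nat.prime_iff.1 p.2) _).1 hp
    rw [Nat.Primes.coe_nat_injective ((Nat.prime_dvd_prime_iff_eq p.2 r.2).1 hpr)]
    exact (Finset.mem_filter.1 hr).2
  · intro w hw p hp
    obtain ⟨r, hr, rfl⟩ := List.mem_map.1 hw
    rw [Nat.Primes.coe_nat_injective hp]
    simpa using (Finset.mem_filter.1 (Finset.mem_toList.1 hr)).2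
  · rintro W' ⟨h1, h2⟩
    refine hIU fun p hp => ?_
    have hWp : W' p = W p := by
      cases h : W p with
      | true =>
        exact h1 p (Finset.dvd_prod_of_mem (fun p : Nat.Primes => (p : ℕ))
          (Finset.mem_filter.2 ⟨hp, h⟩))
      | false =>
        refine h2 ((p : ℕ), q p) (List.mem_map.2 ⟨p, ?_, rfl⟩) p rfl
        exact Finset.mem_toList.2 (Finset.mem_filter.2 ⟨hp, h⟩)
    rw [hWp]
    exact (hu p hp).2

/-- The condition `(a, L)` decides membership of `n` in `HTP(R_W)` for all `W ∈ cylinder a L`. -/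
def Forces (n a : ℕ) (L : List (ℕ × ℕ)) : Bool → Prop
  | true => ∃ x : ℕ → ℚ, aeval x (polyEquiv n) = 0 ∧ ∀ i ≤ n, (x i).den ∣ a
  | false => ¬ SemilocalSolvable n L

theorem Forces.mono {n a a' : ℕ} {L L' : List (ℕ × ℕ)} {b : Bool} (h : Forces n a L b)
    (ha : a ∣ a') (hL : L ⊆ L') : Forces n a' L' b := by
  cases b with
  | true =>
    obtain ⟨x, hx, h⟩ := h
    exact ⟨x, hx, fun i hi => (h i hi).trans ha⟩
  | false =>
    rintro ⟨x, hx, h'⟩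
    exact h ⟨x, hx, fun i w hw => h' i w (hL hw)⟩

/-- For `false`: W omits the primes of L, so a zero in R_W would be integral at all of them. -/
theorem Forces.eq_true_iff {n a : ℕ} {L : List (ℕ × ℕ)} {b : Bool} (h : Forces n a L b)
    (hL : IsAuxList L) {W : Nat.Primes → Bool} (hW : W ∈ cylinder a L) :
    b = true ↔ n ∈ HTPCode (subringOf {p | W p = true}) := by
  rw [mem_HTPCode_subringOf_iff]
  cases b with
  | true =>
    obtain ⟨x, hx, h⟩ := h
    refine iff_of_true rfl ⟨fun i => if i ≤ n then x i else 0, ?_, fun i p hp => ?_⟩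
    · rw [← hx]
      exact aeval_polyEquiv_congr fun i hi => if_pos hi
    · beta_reduce at hp
      split_ifs at hp with hi
      · exact hW.1 p (hp.trans (h i hi))
      · exact absurd (Nat.dvd_one.1 hp) p.2.one_lt.ne'
  | false =>
    refine iff_of_false Bool.false_ne_true ?_
    rintro ⟨x, hx, h'⟩
    refine h ⟨x, hx, fun i w hw hd => ?_⟩
    have h1 : W ⟨w.1, (hL w hw).prime⟩ = true := h' i ⟨w.1, (hL w hw).prime⟩ hd
    rw [hW.2 w hw ⟨w.1, (hL w hw).prime⟩ rfl] at h1
    exact Bool.false_ne_true h1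

/-- Makes positive forcing searchable: guess the numerators c and query HTP(ℚ). Since a ≠ 0, they
determine x₀, …, xₙ. -/
theorem forces_true_iff {n a : ℕ} {L : List (ℕ × ℕ)} (ha : a ≠ 0) :
    Forces n a L true ↔ ∃ c, witnessPoly n a c ∈ HTP ℚ := by
  constructor
  · rintro ⟨x, hx, h⟩
    exact exists_witnessPoly_mem_HTP hx h
  · rintro ⟨c, hc⟩
    obtain ⟨x, hx, h⟩ := witnessPoly_mem_HTP_iff.1 hc
    refine ⟨x, hx, fun i hi => ?_⟩
    have ha' : (a : ℚ) ≠ 0 := by exact_mod_cast ha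
    have hxi : x i = Rat.divInt (((c.getD i (0, 0)).1 : ℤ) - (c.getD i (0, 0)).2) a := by
      rw [Rat.divInt_eq_div, eq_div_iff (by exact_mod_cast ha'), mul_comm]
      push_cast
      exact h i hi
    rw [hxi]
    exact Int.natCast_dvd_natCast.1 (Rat.den_dvd _ _)

/-- A set of primes is generic if each `n` is decided by a condition that it meets. -/
def genericSets : Set (Nat.Primes → Bool) :=
  {W | ∀ n, ∃ a L b, a ≠ 0 ∧ IsAuxList L ∧ W ∈ cylinder a L ∧ Forces n a L b}

/-- A condition is consistent as soon as no prime of L divides a: the prime divisors of a form its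
least member. -/
theorem mem_cylinder_of_not_dvd {a : ℕ} {L : List (ℕ × ℕ)} (h : ∀ w ∈ L, ¬ w.1 ∣ a) :
    (fun p : Nat.Primes => decide ((p : ℕ) ∣ a)) ∈ cylinder a L :=
  ⟨fun _ hp => decide_eq_true hp, fun w hw p hp => decide_eq_false (by rw [hp]; exact h w hw)⟩

theorem not_dvd_of_mem_cylinder {a : ℕ} {L : List (ℕ × ℕ)} (hL : IsAuxList L)
    {W : Nat.Primes → Bool} (hW : W ∈ cylinder a L) : ∀ w ∈ L, ¬ w.1 ∣ a := by
  intro w hw hd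
  have h1 := hW.1 ⟨w.1, (hL w hw).prime⟩ hd
  rw [hW.2 w hw ⟨w.1, (hL w hw).prime⟩ rfl] at h1
  exact Bool.false_ne_true h1

theorem isMeagre_compl_genericSets : IsMeagre genericSetsᶜ := by
  let O : ℕ → Set (Nat.Primes → Bool) := fun n =>
    {W | ∃ a L b, a ≠ 0 ∧ IsAuxList L ∧ W ∈ cylinder a L ∧ Forces n a L b}
  have hO : ∀ n, IsOpen (O n) := by
    intro n
    have : O n = ⋃ (a) (L) (_ : a ≠ 0 ∧ IsAuxList L ∧ ∃ b, Forces n a L b), cylinder a L := by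
      ext W
      simp only [O, Set.mem_ofPred_eq, Set.mem_iUnion]
      constructor
      · rintro ⟨a, L, b, h1, h2, h3, h4⟩
        exact ⟨a, L, ⟨h1, h2, b, h4⟩, h3⟩
      · rintro ⟨a, L, ⟨h1, h2, b, h4⟩, h3⟩
        exact ⟨a, L, b, h1, h2, h3, h4⟩
    rw [this]
    exact isOpen_iUnion fun a => isOpen_iUnion fun L => isOpen_iUnion fun h =>
      isOpen_cylinder h.1 L
  have hd : ∀ n, Dense (O n) := by
    intro n
    rw [dense_iff_inter_open]
    rintro U hU ⟨W, hW⟩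
    obtain ⟨a, L, ha, hL, hWa, hsub⟩ := exists_cylinder_subset hU hW
    -- Denominators of a zero integral at L may be adjoined to a consistently. Without such a zero
    -- the condition already forces `false`.
    by_cases hs : SemilocalSolvable n L
    · obtain ⟨x, hx, h⟩ := hs
      set d := ∏ i ∈ Finset.range (n + 1), (x i).den with hdd
      have hnd : ∀ w ∈ L, ¬ w.1 ∣ a * d := by
        intro w hw hd
        rcases (hL w hw).prime.dvd_mul.1 hd with hd | hd
        · exact not_dvd_of_mem_cylinder hL hWa w hw hd
        · obtain ⟨i, -, hi⟩ := (Prime.dvd_finsetProd_iff (Nat.prime_iff.1 (hL w hw).prime) _).1 hd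
          exact h i w hw hi
      have hcyl := mem_cylinder_of_not_dvd hnd
      refine ⟨_, hsub ⟨fun p hp => hcyl.1 p (hp.mul_right _), hcyl.2⟩, a * d, L, true, ?_, hL,
        hcyl, x, hx, fun i hi => ?_⟩
      · exact mul_ne_zero ha (Finset.prod_ne_zero_iff.2 fun i _ => (x i).den_nz)
      · exact (Finset.dvd_prod_of_mem (fun i => (x i).den)
          (Finset.mem_range.2 (Nat.lt_succ_of_le hi))).mul_left a
    · exact ⟨W, hW, a, L, false, ha, hL, hWa, hs⟩
  have : genericSetsᶜ = ⋃ n, (O n)ᶜ := by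
    rw [← Set.compl_iInter]
    congr 1
    ext W
    simp [genericSets, O]
  rw [this]
  refine isMeagre_iUnion fun n => IsNowhereDense.isMeagre ?_
  exact (isClosed_isNowhereDense_iff_compl.2 (by rw [compl_compl]; exact ⟨hO n, hd n⟩)).2

end Forcing

/-! ### Decidability of forcing and the nowhere dense sets -/

section Search

open Encodable

variable {α : Type*} [Primcodable α]

theorem ComputablePred.forall_lt {m : α → ℕ} {R : α → ℕ → Prop} (hm : Computable m)
    (hR : ComputablePred fun u : α × ℕ => R u.1 u.2) : ComputablePred fun a => ∀ j < m a, R a j := by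
  classical
  have hd : Computable fun u : α × ℕ => decide (R u.1 u.2) := hR.decide
  have h : Computable fun a => decide (∀ j < m a, R a j) := by
    refine (Computable.nat_rec (f := m) (g := fun _ => true)
      (h := fun a w => w.2 && decide (R a w.1)) hm (Computable.const true) ?_).of_eq fun a => ?_
    · exact (Primrec.dom_bool₂ (· && ·)).to_comp.comp (Computable.snd.comp .snd)
        (hd.comp (Computable.fst.pair (Computable.fst.comp .snd)))
    · induction m a with
      | zero => simp
      | succ n ih =>
        dsimp only at ih ⊢
        rw [ih, Bool.eq_iff_iff, Bool.and_eq_true, decide_eq_true_iff, decide_eq_true_iff,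
          decide_eq_true_iff, Nat.forall_lt_succ_right]
  exact h.computablePred

theorem primrecPred_dvd {f g : α → ℕ} (hf : Primrec f) (hg : Primrec g) :
    PrimrecPred fun a => f a ∣ g a :=
  (Primrec.eq.comp (Primrec.nat_mod.comp hg hf) (Primrec.const 0)).of_eq
    fun _ => Nat.dvd_iff_mod_eq_zero.symm

theorem primrecPred_prime : PrimrecPred Nat.Prime := by
  have h : PrimrecRel fun m p : ℕ => m ∣ p → m = 1 :=
    ((primrecPred_dvd Primrec.fst Primrec.snd).not.or
      (Primrec.eq.comp Primrec.fst (Primrec.const 1))).of_eq fun _ => imp_iff_not_or.symm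
  exact ((Primrec.nat_le.comp (Primrec.const 2) Primrec.id).and
    (h.forall_lt.comp Primrec.id Primrec.id)).of_eq fun p => Nat.prime_def_lt.symm

/-- The quantifier over t is bounded, so a search can verify the auxiliary numbers it guesses. -/
theorem primrecRel_isAuxPair : PrimrecRel IsAuxPair := by
  have h : PrimrecRel fun (t : ℕ) (w : ℕ × ℕ) => ¬ w.1 ∣ t ^ 2 + w.2 := by
    have hsq : Primrec fun u : ℕ × ℕ × ℕ => u.1 ^ 2 :=
      (Primrec.nat_mul.comp Primrec.fst Primrec.fst).of_eq fun u => (sq u.1).symm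
    exact (primrecPred_dvd (Primrec.fst.comp Primrec.snd)
      (Primrec.nat_add.comp hsq (Primrec.snd.comp Primrec.snd))).not
  have h' : PrimrecPred fun w : ℕ × ℕ => ∀ t < w.1, ¬ w.1 ∣ t ^ 2 + w.2 :=
    ((h.forall_mem_list).comp (Primrec.list_range.comp Primrec.fst) Primrec.id).of_eq
      fun w => by simp
  have h2 : PrimrecPred fun w : ℕ × ℕ => w.1 = 2 :=
    Primrec.eq.comp Primrec.fst (Primrec.const 2)
  exact (h2.and (Primrec.eq.comp Primrec.snd (Primrec.const 1))).or
    (h2.not.and ((primrecPred_prime.comp Primrec.fst).and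
      ((primrecPred_prime.comp Primrec.snd).and
        ((Primrec.eq.comp (Primrec.nat_mod.comp Primrec.snd (Primrec.const 8))
          (Primrec.const 7)).and h'))))

theorem ComputablePred.and {p q : α → Prop} (hp : ComputablePred p) (hq : ComputablePred q) :
    ComputablePred fun a => p a ∧ q a := by
  classical
  exact Computable.computablePred (((Primrec.dom_bool₂ (· && ·)).to_comp.comp hp.decide
    hq.decide).of_eq fun a => (Bool.decide_and _ _).symm)

theorem ComputablePred.or {p q : α → Prop} (hp : ComputablePred p) (hq : ComputablePred q) :
    ComputablePred fun a => p a ∨ q a := by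
  classical
  exact Computable.computablePred (((Primrec.dom_bool₂ (· || ·)).to_comp.comp hp.decide
    hq.decide).of_eq fun a => (Bool.decide_or _ _).symm)

theorem ComputablePred.comp {β : Type*} [Primcodable β] {p : β → Prop} {f : α → β}
    (hp : ComputablePred p) (hf : Computable f) : ComputablePred fun a => p (f a) := by
  classical
  exact Computable.computablePred (hp.decide.comp hf)

theorem computablePred_mem_HTP (hQ : DecidableSet (HTPCode ℚ)) :
    ComputablePred fun f : MvPolynomial ℕ ℤ => f ∈ HTP ℚ := by
  have h := ComputablePred.comp hQ primrec_polyEquiv_symm.to_comp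
  simpa [HTPCode] using h

/-- The value `e.1` of the characteristic function of `HTP(R_W)` at `j` is forced by the condition
`(a, L)`; if it is `true`, then `e.2` lists the numerators of a zero with denominator `a`. -/
def IsForcedEntry (j a : ℕ) (L : List (ℕ × ℕ)) (e : Bool × List (ℕ × ℕ)) : Prop :=
  (e.1 = true ∧ witnessPoly j a e.2 ∈ HTP ℚ) ∨ (e.1 = false ∧ semilocalPoly j L ∉ HTP ℚ)

theorem ComputablePred.isForcedEntry (hQ : DecidableSet (HTPCode ℚ)) {j a : α → ℕ}
    {L : α → List (ℕ × ℕ)} {e : α → Bool × List (ℕ × ℕ)} (hj : Computable j) (ha : Computable a)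
    (hL : Computable L) (he : Computable e) :
    ComputablePred fun u => IsForcedEntry (j u) (a u) (L u) (e u) := by
  have hH := computablePred_mem_HTP hQ
  have hb : ∀ b : Bool, ComputablePred fun u => (e u).1 = b := fun b =>
    ComputablePred.comp (p := fun b' : Bool => b' = b)
      (PrimrecPred.computablePred (Primrec.eq.comp Primrec.id (Primrec.const b)))
      (Computable.fst.comp he)
  have hw : Computable fun u => witnessPoly (j u) (a u) (e u).2 :=
    Computable.comp (f := fun v : ℕ × ℕ × List (ℕ × ℕ) => witnessPoly v.1 v.2.1 v.2.2)
      (g := fun u => (j u, a u, (e u).2)) computable_witnessPoly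
      (hj.pair (ha.pair (Computable.snd.comp he)))
  have hs : Computable fun u => semilocalPoly (j u) (L u) := computable_semilocalPoly.comp hj hL
  exact ComputablePred.or
    (ComputablePred.and (hb true) (ComputablePred.comp (f := fun u => witnessPoly _ _ _) hH hw))
    (ComputablePred.and (hb false)
      (ComputablePred.comp (f := fun u => semilocalPoly _ _) hH hs).not)

/-- `β` lists the initial values of the characteristic function of `HTP(R_W)` that are forced by
the condition `(a, L)`, each with the numerators of a zero if its value is `true`. -/
def IsForcingList (a : ℕ) (L : List (ℕ × ℕ)) (β : List (Bool × List (ℕ × ℕ))) : Prop :=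
  ∀ j < β.length, IsForcedEntry j a L (β.getD j (false, []))

theorem computablePred_isForcingList (hQ : DecidableSet (HTPCode ℚ)) :
    ComputablePred fun s : ℕ × List (ℕ × ℕ) × List (Bool × List (ℕ × ℕ)) =>
      IsForcingList s.1 s.2.1 s.2.2 :=
  ComputablePred.forall_lt (α := ℕ × List (ℕ × ℕ) × List (Bool × List (ℕ × ℕ)))
    (m := fun s => s.2.2.length)
    (R := fun s j => IsForcedEntry j s.1 s.2.1 (s.2.2.getD j (false, [])))
    (Computable.list_length.comp (Computable.snd.comp .snd))
    (ComputablePred.isForcedEntry hQ .snd (Computable.fst.comp .fst)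
      (Computable.fst.comp (Computable.snd.comp .fst))
      ((Primrec.list_getD _).to_comp.comp (Computable.snd.comp (Computable.snd.comp .fst)) .snd))

theorem IsForcingList.forces {a : ℕ} {L : List (ℕ × ℕ)} {β : List (Bool × List (ℕ × ℕ))}
    (h : IsForcingList a L β) (ha : a ≠ 0) (hL : IsAuxList L) {j : ℕ} (hj : j < β.length) :
    Forces j a L β[j].1 := by
  have := h j hj
  rw [List.getD_eq_getElem _ _ hj] at this
  rcases this with ⟨hb, h⟩ | ⟨hb, h⟩
  · rw [hb]
    exact (forces_true_iff ha).2 ⟨_, h⟩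
  · rw [hb]
    rwa [semilocalPoly_mem_HTP_iff hL] at h

theorem IsForcingList.map_fst_eq {a : ℕ} {L : List (ℕ × ℕ)} {β : List (Bool × List (ℕ × ℕ))}
    (h : IsForcingList a L β) (ha : a ≠ 0) (hL : IsAuxList L) {W : Nat.Primes → Bool}
    (hW : W ∈ cylinder a L) :
    β.map Prod.fst = initialSegment (HTPCode (subringOf {p | W p = true})) β.length := by
  classical
  refine List.ext_getElem (by simp [initialSegment]) fun j hj _ => ?_
  have hj' : j < β.length := by simpa using hj
  have := (h.forces ha hL hj').eq_true_iff hL hW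
  rw [Bool.eq_iff_iff]
  simp [initialSegment, this]

theorem exists_isForcingList {a : ℕ} {L : List (ℕ × ℕ)} (ha : a ≠ 0) (hL : IsAuxList L) {k : ℕ}
    (h : ∀ j < k, ∃ b, Forces j a L b) : ∃ β, IsForcingList a L β ∧ β.length = k := by
  have hex : ∀ j, ∃ e : Bool × List (ℕ × ℕ), j < k →
      (e.1 = true ∧ witnessPoly j a e.2 ∈ HTP ℚ) ∨
        (e.1 = false ∧ semilocalPoly j L ∉ HTP ℚ) := by
    intro j
    by_cases hj : j < k
    · obtain ⟨b, hb⟩ := h j hj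
      cases b with
      | true =>
        obtain ⟨c, hc⟩ := (forces_true_iff ha).1 hb
        exact ⟨(true, c), fun _ => Or.inl ⟨rfl, hc⟩⟩
      | false => exact ⟨(false, []), fun _ => Or.inr ⟨rfl, by rwa [semilocalPoly_mem_HTP_iff hL]⟩⟩
    · exact ⟨(false, []), fun hj' => absurd hj' hj⟩
  choose e he using hex
  refine ⟨(List.range k).map e, fun j hj => ?_, by simp⟩
  have hj' : j < k := by simpa using hj
  rw [List.getD_eq_getElem _ _ hj, List.getElem_map, List.getElem_range]
  exact he j hj'

/-- Finitely many conditions met by W are merged by multiplying the a's and concatenating the L's.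
-/
theorem exists_forces_of_mem_genericSets {W : Nat.Primes → Bool} (hW : W ∈ genericSets) (k : ℕ) :
    ∃ a L, a ≠ 0 ∧ IsAuxList L ∧ W ∈ cylinder a L ∧ ∀ j < k, ∃ b, Forces j a L b := by
  induction k with
  | zero =>
    refine ⟨1, [], one_ne_zero, by simp [IsAuxList], ⟨fun p hp => ?_, by simp⟩, by simp⟩
    exact absurd (Nat.dvd_one.1 hp) p.2.one_lt.ne'
  | succ k ih =>
    obtain ⟨a, L, ha, hL, hWa, h⟩ := ih
    obtain ⟨a', L', b, ha', hL', hWa', h'⟩ := hW k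
    refine ⟨a * a', L ++ L', mul_ne_zero ha ha', hL.append hL',
      by rw [cylinder_mul_append]; exact ⟨hWa, hWa'⟩, fun j hj => ?_⟩
    rcases Nat.lt_succ_iff_lt_or_eq.1 hj with hj | rfl
    · obtain ⟨c, hc⟩ := h j hj
      exact ⟨c, hc.mono (dvd_mul_right _ _) (List.subset_append_left _ _)⟩
    · exact ⟨b, h'.mono (dvd_mul_left _ _) (List.subset_append_right _ _)⟩

/-- The generic `W` for which the program `c` computes `D` from `HTP(R_W)`. -/
def computingSets (D : Set ℕ) (c : Nat.Partrec.Code) : Set (Nat.Primes → Bool) :=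
  {W | W ∈ genericSets ∧ ∀ x y, y ∈ chi D x ↔ ∃ k, y ∈ c.eval (Nat.pair
    (encode (initialSegment (HTPCode (subringOf {p | W p = true})) k)) x)}

/-- A condition `s.1, s.2.1` together with a list of values that it forces. -/
def IsForcingDatum (s : ℕ × List (ℕ × ℕ) × List (Bool × List (ℕ × ℕ))) : Prop :=
  s.1 ≠ 0 ∧ IsAuxList s.2.1 ∧ (∀ w ∈ s.2.1, ¬ w.1 ∣ s.1) ∧ IsForcingList s.1 s.2.1 s.2.2

theorem computablePred_isForcingDatum (hQ : DecidableSet (HTPCode ℚ)) :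
    ComputablePred IsForcingDatum := by
  refine ComputablePred.and (PrimrecPred.computablePred ?_) (ComputablePred.and
    (PrimrecPred.computablePred ?_) (ComputablePred.and (PrimrecPred.computablePred ?_)
      (computablePred_isForcingList hQ)))
  · exact (Primrec.eq.comp Primrec.fst (Primrec.const 0)).not
  · exact (PrimrecPred.forall_mem_list
      (p := fun w : ℕ × ℕ => IsAuxPair w.1 w.2) primrecRel_isAuxPair).comp
      (Primrec.fst.comp Primrec.snd)
  · have h : PrimrecRel fun (w : ℕ × ℕ) (a : ℕ) => ¬ w.1 ∣ a :=
      (primrecPred_dvd (Primrec.fst.comp Primrec.fst) Primrec.snd).not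
    exact h.forall_mem_list.comp (Primrec.fst.comp Primrec.snd) Primrec.fst

open Classical in
/-- The output of `c` on the input `u.1` and the oracle values forced by `u.2`. -/
noncomputable def forcedOutput (c : Nat.Partrec.Code)
    (u : ℕ × (ℕ × List (ℕ × ℕ) × List (Bool × List (ℕ × ℕ)))) : Part ℕ :=
  bif decide (IsForcingDatum u.2) then c.eval (Nat.pair (encode (u.2.2.2.map Prod.fst)) u.1)
    else Part.none

theorem partrec_forcedOutput (hQ : DecidableSet (HTPCode ℚ)) (c : Nat.Partrec.Code) :
    Partrec (forcedOutput c) := by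
  classical
  have h1 : Computable fun u : ℕ × (ℕ × List (ℕ × ℕ) × List (Bool × List (ℕ × ℕ))) =>
      decide (IsForcingDatum u.2) :=
    (computablePred_isForcingDatum hQ).decide.comp .snd
  have h2 : Computable fun u : ℕ × (ℕ × List (ℕ × ℕ) × List (Bool × List (ℕ × ℕ))) =>
      u.2.2.2.map Prod.fst :=
    Primrec.to_comp (Primrec.list_map (Primrec.snd.comp (Primrec.snd.comp Primrec.snd))
      (Primrec.fst.comp₂ Primrec₂.right))
  have h3 := Nat.Partrec.Code.eval_part.comp (Computable.const c)
    (Primrec₂.natPair.to_comp.comp (Computable.encode.comp h2) .fst)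
  exact (Partrec.cond h1 h3 Partrec.none).of_eq fun u => by
    rw [forcedOutput]

theorem mem_forcedOutput {c : Nat.Partrec.Code} {x y : ℕ}
    {s : ℕ × List (ℕ × ℕ) × List (Bool × List (ℕ × ℕ))} : y ∈ forcedOutput c (x, s) ↔
      IsForcingDatum s ∧ y ∈ c.eval (Nat.pair (encode (s.2.2.map Prod.fst)) x) := by
  by_cases hv : IsForcingDatum s <;> simp [forcedOutput, hv]

/-- If the closure had an interior point W₀ in the set, D would be computed by searching for forced
oracle values inside a cylinder around W₀ in which the set is dense. -/
theorem isNowhereDense_computingSets (hQ : DecidableSet (HTPCode ℚ)) {D : Set ℕ}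
    (hD : ¬ Partrec (chi D)) (c : Nat.Partrec.Code) : IsNowhereDense (computingSets D c) := by
  classical
  rw [isNowhereDense_iff_forall_notMem_nhds]
  intro W₀ hW₀ hnhds
  obtain ⟨U, hUT, hU, hWU⟩ := mem_nhds_iff.1 hnhds
  obtain ⟨a₀, L₀, ha₀, hL₀, hWa₀, hsub⟩ := exists_cylinder_subset hU hWU
  apply hD
  have hext : Computable fun u : ℕ × (ℕ × List (ℕ × ℕ) × List (Bool × List (ℕ × ℕ))) =>
      (u.1, a₀ * u.2.1, L₀ ++ u.2.2.1, u.2.2.2) := by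
    have h1 := Primrec.nat_mul.comp (Primrec.const a₀) (Primrec.fst.comp (Primrec.snd (α := ℕ)
      (β := ℕ × List (ℕ × ℕ) × List (Bool × List (ℕ × ℕ)))))
    have h2 : Primrec fun u : ℕ × (ℕ × List (ℕ × ℕ) × List (Bool × List (ℕ × ℕ))) => u.2.2 :=
      Primrec.snd.comp Primrec.snd
    exact (Primrec.fst.pair (h1.pair ((Primrec.list_append.comp (Primrec.const L₀)
      (Primrec.fst.comp h2)).pair (Primrec.snd.comp h2)))).to_comp
  have hcomp : Computable fun x => if x ∈ D then 1 else 0 := by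
    refine computable_of_search ((partrec_forcedOutput hQ c).comp hext) (fun x s y hy => ?_) (fun x => ?_)
    -- Soundness: the extended cylinder is open, nonempty and inside the closure, so it contains
    -- some W in the set. Its oracle begins with the forced values, so the output is the value of D.
    · obtain ⟨⟨ha, hL, hnd, hβ⟩, hy⟩ := mem_forcedOutput.1 hy
      have hne := mem_cylinder_of_not_dvd hnd
      have hcl := hUT (hsub (by rw [cylinder_mul_append] at hne; exact hne.1))
      obtain ⟨W, hWc, hWT⟩ := mem_closure_iff.1 hcl _ (isOpen_cylinder ha _) hne
      rw [hβ.map_fst_eq ha hL hWc] at hy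
      simpa [chi] using (hWT.2 x y).2 ⟨_, hy⟩
    -- Completeness: the computation from W₀ uses k oracle values, and genericity of W₀ supplies a
    -- condition forcing all of them.
    · obtain ⟨k, hk⟩ := (hW₀.2 x (if x ∈ D then 1 else 0)).1 (by simp [chi])
      obtain ⟨a, L, ha, hL, hWa, hf⟩ := exists_forces_of_mem_genericSets hW₀.1 k
      have ha' := mul_ne_zero ha₀ ha
      have hL' := hL₀.append hL
      have hWa' : W₀ ∈ cylinder (a₀ * a) (L₀ ++ L) := by
        rw [cylinder_mul_append]
        exact ⟨hWa₀, hWa⟩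
      obtain ⟨β, hβ, rfl⟩ := exists_isForcingList ha' hL' (k := k) fun j hj => (hf j hj).imp
        fun b hb => hb.mono (dvd_mul_left _ _) (List.subset_append_right _ _)
      refine ⟨(a, L, β), Part.dom_iff_mem.2 ⟨if x ∈ D then 1 else 0,
        mem_forcedOutput.2 ⟨⟨ha', hL', not_dvd_of_mem_cylinder hL' hWa', hβ⟩, ?_⟩⟩⟩
      rwa [hβ.map_fst_eq ha' hL' hWa']
  exact hcomp.partrec.of_eq fun x => by simp [chi]

end Search

end HTPBaire

/-- The space of all sets of primes is `Nat.Primes → Bool` with the product topology; the point `W`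
stands for the set `{p | W p = true}`. -/
theorem proposition3p4 (hQ : HTPBaire.DecidableSet (HTPBaire.HTPCode ℚ)) :
    IsMeagre {W : Nat.Primes → Bool |
      ∃ D : Set ℕ,
        HTPBaire.SetTuringLE D HTPBaire.haltingSet ∧
        HTPBaire.SetTuringLT ∅ D ∧
        HTPBaire.SetTuringLE D
          (HTPBaire.HTPCode (HTPBaire.subringOf {p | W p = true}))} := by
  let S : Set (Set ℕ) := {D | HTPBaire.SetTuringLE D HTPBaire.haltingSet}
  have : Countable S := (HTPBaire.countable_setOf_setTuringLE HTPBaire.haltingSet).to_subtype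
  -- With noncomputability inside the set, the union can run over all D ≤_T ∅'; computable D
  -- contribute nothing.
  have hmeagre : ∀ (D : S) (c : Nat.Partrec.Code),
      IsMeagre {W | W ∈ HTPBaire.computingSets D.1 c ∧ ¬ Partrec (HTPBaire.chi D.1)} := by
    intro D c
    by_cases hD : Partrec (HTPBaire.chi D.1)
    · simpa [hD] using IsMeagre.empty
    · exact (HTPBaire.isNowhereDense_computingSets hQ hD c).isMeagre.mono fun W hW => hW.1
  refine IsMeagre.mono ?_ (HTPBaire.isMeagre_compl_genericSets.union
    (isMeagre_iUnion fun D : S => isMeagre_iUnion fun c : Nat.Partrec.Code => hmeagre D c))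
  rintro W ⟨D, hD, hlt, hle⟩
  by_cases hW : W ∈ HTPBaire.genericSets
  · obtain ⟨c, hc⟩ := HTPBaire.exists_code_of_setTuringLE hle
    exact Or.inr (Set.mem_iUnion.2 ⟨⟨D, hD⟩, Set.mem_iUnion.2
      ⟨c, ⟨hW, hc⟩, fun hp => hlt.2 hp.turingReducible⟩⟩)
  · exact Or.inl hW
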